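/- **Conventions.** $G=(V,E)$ is a finite directed graph without self-loops or repeated edges (antiparallel pairs are allowed), $m=|E|$. For an edge $e=(u,v)$, $u$ is its head and $v$ its tail; $d^{\rm out}_v$, $d^{\rm in}_v$ count the edges with head, respectively tail, $v$; $d_v$ is the degree and $b_v=(d_v^{\rm out}-d_v^{\rm in})/d_v$ the bias. $\mathrm{Max\text{-}DiCut}(G)=\max_{x\in\{0,1\}^V}|\{(u,v)\in E: x_u=0,\,x_v=1\}|$. For $X,X'\ge 0$, $X'$ is an $\alpha$-approximation of $X$ if $\alpha X\le X'\le X$. For thresholds $\mathbf t\in[-1,1]^\ell$ the bias intervals are $[\mathbf t_i,\mathbf t_{i+1})$ for $i<\ell$ and $[\mathbf t_\ell,1]$ for $i=\ell$. The snapshot $H_G\in\mathbb N^{\ell\times\ell}$ has as entry $(i,j)$ the number of edges $(u,v)$ with $b_u$ in the $i$-th and $b_v$ in the $j$-th bias interval. **Pseudosnapshot.** Let $0<\varepsilon\le 1$, let $\kappa>0$ be real, and let $N$ be an integer with $d_v\le N$ for all $v$ (for instance $N=|V|$ if there are no antiparallel edges; $N=2|V|$ always works). Put $K=\lfloor\log_{1+\varepsilon^3}N\rfloor$,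 $d_i=\lfloor(1+\varepsilon^3)^i\rfloor$ for $0\le i<K$, $d_K=N$, and $p_i=\min\{1,\kappa/(2d_i)\}$. Let $f_i(e)\in\{0,1\}$ ($0\le i\le K$, $e\in E$) and $g(v)$ ($v\in V$) be independent random variables with $\Pr[f_i(e)=1]=p_i$ and $g(v)$ uniform on $[-\varepsilon,\varepsilon]$. The edges arrive in an arbitrary fixed order. For an edge $e$ and an endpoint $v$ of $e$, let $d_v^{\le e}$ be the degree of $v$ among $e$ and the edges arriving before $e$, and let $d_v^{>e}$, $d_v^{{\rm out},>e}$ be the degree and out-degree of $v$ among the edges arriving after $e$. Let $\tilde\imath$ be the largest $i\le K$ with $d_i\le d_v^{\le e}$, and let $\hat d_v^{\,{\rm out},\le e}$ be $1/p_{\tilde\imath}$ times the number of edges $e'$ with head $v$ and $f_{\tilde\imath}(e')=1$ among $e$ and the edges arriving before $e$. The $e$-pseudobias of $v$ is $$\hat b_v^{\,e}=\max\Bigl\{-1,\ \min\Bigl\{2\,\frac{\hat d_v^{\,{\rm out},\le e}+d_v^{{\rm out},>e}}{d_{\tilde\imath}+d_v^{>e}}-1+g(v),\ 1\Bigr\}\Bigr\}.$$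 The pseudosnapshot $\hat H_G\in\mathbb N^{\ell\times\ell}$ has as entry $(i,j)$ the number of edges $e=(u,v)$ with $\hat b^{\,e}_u$ in the $i$-th and $\hat b^{\,e}_v$ in the $j$-th bias interval. **Statement.** Let $\alpha>0.4844$, $\ell\in\mathbb N$, $\mathbf t\in[-1,1]^\ell$ and $\mathbf r\in[0,1]^\ell$ be such that $\mathbf r^{\top}H_G(1^\ell-\mathbf r)$ is an $\alpha$-approximation of $\mathrm{Max\text{-}DiCut}(G)$ for every directed graph $G$. Then there are constants $C,A,B,c>0$, depending only on $\alpha,\ell,\mathbf t,\mathbf r$, such that for every directed graph $G$, every arrival order of its edges, and all $N,\varepsilon,\kappa$ as above, $$\mathbf r^{\top}\hat H_G(1^\ell-\mathbf r)-C\varepsilon m$$ is an $(\alpha-A\varepsilon)$-approximation of $\mathrm{Max\text{-}DiCut}(G)$ with probability at least $1-B\varepsilon-e^{-c\,\varepsilon^6\kappa}$ over $(f_i)_i$ and $g$. -/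

import Mathlib

open MeasureTheory ProbabilityTheory

noncomputable section

/-- A finite directed graph without self-loops and without repeated edges. The pair `(u, v)` is the
edge from `u` (its head, in the convention used here) to `v` (its tail). Antiparallel pairs are
allowed. -/
structure SimpleDigraph (V : Type) where
  edges : Finset (V × V)
  loopless : ∀ e ∈ edges, e.1 ≠ e.2

namespace SimpleDigraph

variable {V : Type} [DecidableEq V]

/-- The number `m` of edges. -/
def numEdges (G : SimpleDigraph V) : ℕ := G.edges.card

def outDegree (G : SimpleDigraph V) (v : V) : ℕ := (G.edges.filter fun e => e.1 = v).card

def inDegree (G : SimpleDigraph V) (v : V) : ℕ := (G.edges.filter fun e => e.2 = v).card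

/-- The total degree `d_v`. -/
def degree (G : SimpleDigraph V) (v : V) : ℕ :=
  (G.edges.filter fun e => e.1 = v ∨ e.2 = v).card

/-- The bias `b_v = (d_v^out - d_v^in) / d_v`. -/
def bias (G : SimpleDigraph V) (v : V) : ℝ :=
  ((G.outDegree v : ℝ) - (G.inDegree v : ℝ)) / (G.degree v : ℝ)

/-- The maximum number of edges going from side `0` (`false`) to side `1` (`true`) of a
bipartition of the vertex set. -/
def maxDicut [Fintype V] (G : SimpleDigraph V) : ℕ :=
  Finset.univ.sup fun x : V → Bool =>
    (G.edges.filter fun e => x e.1 = false ∧ x e.2 = true).card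

end SimpleDigraph

/-- `X'` is an `α`-approximation of `X`, for non-negative reals `X` and `X'`. -/
def Approximates (α X' X : ℝ) : Prop :=
  0 ≤ X ∧ 0 ≤ X' ∧ X' ∈ Set.Icc (α * X) X

/-- The `i`-th bias interval: `[t_i, t_{i+1})`, and `[t_ℓ, 1]` for the last index. -/
def biasInterval {ℓ : ℕ} (t : Fin ℓ → ℝ) (i : Fin ℓ) : Set ℝ :=
  if h : (i : ℕ) + 1 < ℓ then Set.Ico (t i) (t ⟨(i : ℕ) + 1, h⟩) else Set.Icc (t i) 1

open scoped Classical in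
/-- The (first-order) snapshot of `G` with respect to the thresholds `t`: the entry `(i, j)` counts
the edges `(u, v)` for which `b_u` is in the `i`-th and `b_v` in the `j`-th bias interval. -/
def snapshot {V : Type} [DecidableEq V] {ℓ : ℕ} (t : Fin ℓ → ℝ) (G : SimpleDigraph V) :
    Matrix (Fin ℓ) (Fin ℓ) ℕ :=
  Matrix.of fun i j => (G.edges.filter fun e =>
    G.bias e.1 ∈ biasInterval t i ∧ G.bias e.2 ∈ biasInterval t j).card

/-- The number `rᵀ H (1 - r)`. -/
def cutValue {ℓ : ℕ} (r : Fin ℓ → ℝ) (H : Matrix (Fin ℓ) (Fin ℓ) ℕ) : ℝ :=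
  dotProduct r (Matrix.mulVec (H.map (Nat.cast : ℕ → ℝ)) (1 - r))

/-- Thresholds `t` and probabilities `r` have snapshot ratio `α`: for every directed graph, the
number `rᵀ H (1 - r)`, with `H` the snapshot, is an `α`-approximation of the maximum directed cut
value. -/
def HasSnapshotRatio {ℓ : ℕ} (α : ℝ) (t r : Fin ℓ → ℝ) : Prop :=
  ∀ (V : Type) [Fintype V] [DecidableEq V] (G : SimpleDigraph V),
    Approximates α (cutValue r (snapshot t G)) (G.maxDicut : ℝ)

/-! ### Degree scale and hash functions -/

/-- The index `⌊log_{1+ε³} N⌋` of the last degree threshold. -/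
def lastLevel (N : ℕ) (ε : ℝ) : ℕ := ⌊Real.logb (1 + ε ^ 3) (N : ℝ)⌋₊

/-- The degree thresholds: `d_i = ⌊(1+ε³)^i⌋` below the last index, and `N` at the last index. -/
def degThreshold (N : ℕ) (ε : ℝ) (i : ℕ) : ℕ :=
  if i < lastLevel N ε then ⌊(1 + ε ^ 3) ^ i⌋₊ else N

/-- The index of the degree class `[d_i, d_{i+1})` that contains `d`: the largest `i`, up to the
last index, with `d_i ≤ d`. -/
def degLevel (N : ℕ) (ε : ℝ) (d : ℕ) : Fin (lastLevel N ε + 1) :=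
  ⟨Nat.findGreatest (fun i => degThreshold N ε i ≤ d) (lastLevel N ε),
    Nat.lt_succ_of_le (Nat.findGreatest_le _)⟩

/-- The sampling probability `κ / (2 d_i)` at level `i`, cut off at `1`. -/
def sampleProb (N : ℕ) (ε κ : ℝ) (i : ℕ) : unitInterval :=
  Set.projIcc 0 1 zero_le_one (κ / (2 * (degThreshold N ε i : ℝ)))

/-- Outcomes of all hash functions: `ω.1 (i, e)` is the bit `f_i(e)` and `ω.2 v` is `g(v)`.
(The bits of pairs that are not edges are never used.) -/
abbrev HashOutcome (V : Type) (N : ℕ) (ε : ℝ) : Type :=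
  (Fin (lastLevel N ε + 1) × (V × V) → Bool) × (V → ℝ)

/-- The law of the hash functions: all values are independent, `f_i(e)` is `1` with the sampling
probability of level `i`, and `g(v)` is uniform on `[-ε, ε]`. -/
def hashLaw (V : Type) [Fintype V] (N : ℕ) (ε κ : ℝ) : Measure (HashOutcome V N ε) :=
  (Measure.pi fun x : Fin (lastLevel N ε + 1) × (V × V) =>
      bernoulliMeasure true false (sampleProb N ε κ (x.1 : ℕ))).prod
    (Measure.pi fun _ : V => ProbabilityTheory.cond (volume : Measure ℝ) (Set.Icc (-ε) ε))

/-! ### Pseudobias and pseudosnapshot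

The arrival order of the edges is given by arrival times `τ`, injective on the edge set. -/

section Pseudo

variable {V : Type} [DecidableEq V]

/-- The degree of `v` among `e` and the edges that arrive before `e`. -/
def degUpTo (G : SimpleDigraph V) (τ : V × V → ℕ) (e : V × V) (v : V) : ℕ :=
  (G.edges.filter fun e' => (e'.1 = v ∨ e'.2 = v) ∧ τ e' ≤ τ e).card

/-- The degree of `v` among the edges that arrive after `e`. -/
def degAfter (G : SimpleDigraph V) (τ : V × V → ℕ) (e : V × V) (v : V) : ℕ :=
  (G.edges.filter fun e' => (e'.1 = v ∨ e'.2 = v) ∧ τ e < τ e').card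

/-- The out-degree of `v` among the edges that arrive after `e`. -/
def outAfter (G : SimpleDigraph V) (τ : V × V → ℕ) (e : V × V) (v : V) : ℕ :=
  (G.edges.filter fun e' => e'.1 = v ∧ τ e < τ e').card

/-- The degree level of `v` when `e` arrives. -/
def levelAt (G : SimpleDigraph V) (τ : V × V → ℕ) (N : ℕ) (ε : ℝ) (e : V × V) (v : V) :
    Fin (lastLevel N ε + 1) :=
  degLevel N ε (degUpTo G τ e v)

/-- The estimate of the out-degree of `v` among `e` and the edges that arrive before `e`: the number
of those out-edges of `v` that are sampled by the hash function of the level of `v` when `e`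
arrives, divided by the sampling probability of that level. -/
def outEstimate (G : SimpleDigraph V) (τ : V × V → ℕ) (N : ℕ) (ε κ : ℝ)
    (ω : HashOutcome V N ε) (e : V × V) (v : V) : ℝ :=
  ((G.edges.filter fun e' =>
      e'.1 = v ∧ τ e' ≤ τ e ∧ ω.1 (levelAt G τ N ε e v, e') = true).card : ℝ) /
    (sampleProb N ε κ (levelAt G τ N ε e v : ℕ) : ℝ)

/-- The `e`-pseudobias of `v`, cut off to `[-1, 1]`. -/
def pseudobias (G : SimpleDigraph V) (τ : V × V → ℕ) (N : ℕ) (ε κ : ℝ)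
    (ω : HashOutcome V N ε) (e : V × V) (v : V) : ℝ :=
  max (-1) (min (2 * ((outEstimate G τ N ε κ ω e v + (outAfter G τ e v : ℝ)) /
    ((degThreshold N ε (levelAt G τ N ε e v : ℕ) : ℝ) + (degAfter G τ e v : ℝ))) - 1 + ω.2 v) 1)

open scoped Classical in
/-- The pseudosnapshot: the entry `(i, j)` counts the edges `e = (u, v)` for which the
`e`-pseudobias of `u` is in the `i`-th and that of `v` in the `j`-th bias interval. -/
def pseudosnapshot {ℓ : ℕ} (t : Fin ℓ → ℝ) (G : SimpleDigraph V) (τ : V × V → ℕ) (N : ℕ)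
    (ε κ : ℝ) (ω : HashOutcome V N ε) : Matrix (Fin ℓ) (Fin ℓ) ℕ :=
  Matrix.of fun i j => (G.edges.filter fun e =>
    pseudobias G τ N ε κ ω e e.1 ∈ biasInterval t i ∧
      pseudobias G τ N ε κ ω e e.2 ∈ biasInterval t j).card

end Pseudo

end

/-! Write `β v` for the bias of `v` plus its noise `g(v)`, cut off to `[-1, 1]`. The noise belongs
to the vertex and not to the edge, so `β` is a function on vertices, and the pseudosnapshot can be
compared with the rounding of `β`. The proof combines a deterministic and a probabilistic statement.

Deterministic (`sum_edgeWeight_mem_Icc`): rounding any `β` within `ε` of the true biases keeps the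
guarantee up to `O(ε m)`. The hypothesis speaks only about true biases of graphs, so `β` is
realised, up to an overshoot that crosses no threshold, by a graph. Replace every vertex by `M`
copies, every edge by `M²` copies, and reverse a few half-edges. An edge copy with a reversed half
is subdivided by a new vertex, so that a reversal changes the bias at one end only and preserves
degrees at both. At most `2 ε m M²` edge copies are touched. The other edges see cuts of the blow-up
as fractional cuts of `G`, and these do not beat integral ones; hence the maximum is `M²` times that
of `G` up to `O(ε m M²)`.

Probabilistic (`hashLaw_misclassifiedCount_le`): before noise, the `e`-pseudobias differs from the
bias by at most `14 / (κ ε³) + 13 ε³` in mean, from the sampling variance and the rounding of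
degrees to the geometric scale. A threshold separates the noisy bias from the noisy estimate only if
the noise hits an interval whose length is that difference. The noise is independent of the bits and
has density `1 / (2ε)`, which bounds the expected number of misclassified end points; Markov's
inequality then leaves fewer than `ε m` of them. Each costs at most `ℓ²`.

Additive errors become multiplicative since `m` is at most four times the maximum cut. Second
moments suffice: `tail_bound_le` shows that the resulting bound implies the exponential form. -/

noncomputable section

/-! ### Rounded cuts as sums over edges -/

section Rounding

open scoped Classical in
/-- The total weight of the bias intervals that contain `b`. -/
def intervalWeight {ℓ : ℕ} (t w : Fin ℓ → ℝ) (b : ℝ) : ℝ :=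
  ∑ i, if b ∈ biasInterval t i then w i else 0

lemma intervalWeight_nonneg {ℓ : ℕ} (t : Fin ℓ → ℝ) {w : Fin ℓ → ℝ} (hw : ∀ i, w i ∈ Set.Icc (0 : ℝ) 1)
    (b : ℝ) : 0 ≤ intervalWeight t w b :=
  Finset.sum_nonneg fun i _ => by split_ifs; exacts [(hw i).1, le_rfl]

/-- The thresholds need not be sorted, so the intervals may overlap; this is why the bound is `ℓ`
and not `1`. -/
lemma intervalWeight_le {ℓ : ℕ} (t : Fin ℓ → ℝ) {w : Fin ℓ → ℝ} (hw : ∀ i, w i ∈ Set.Icc (0 : ℝ) 1)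
    (b : ℝ) : intervalWeight t w b ≤ ℓ := by
  calc intervalWeight t w b ≤ ∑ _i : Fin ℓ, (1 : ℝ) :=
        Finset.sum_le_sum fun i _ => by split_ifs; exacts [(hw i).2, zero_le_one]
    _ = ℓ := by simp

/-- All intervals are closed on the left, and open on the right unless they end at `1`. Hence only
the comparisons `t i ≤ b` matter, and this is the sole way in which biases are compared below. -/
lemma mem_biasInterval_congr {ℓ : ℕ} {t : Fin ℓ → ℝ} {a b : ℝ} (ha : a ≤ 1) (hb : b ≤ 1)
    (h : ∀ i, t i ≤ a ↔ t i ≤ b) (i : Fin ℓ) : a ∈ biasInterval t i ↔ b ∈ biasInterval t i := by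
  unfold biasInterval
  split_ifs with hi
  · simp only [Set.mem_Ico, ← not_le, h]
  · simp only [Set.mem_Icc, ha, hb, h]

lemma intervalWeight_congr {ℓ : ℕ} {t : Fin ℓ → ℝ} (w : Fin ℓ → ℝ) {a b : ℝ} (ha : a ≤ 1)
    (hb : b ≤ 1) (h : ∀ i, t i ≤ a ↔ t i ≤ b) : intervalWeight t w a = intervalWeight t w b := by
  refine Finset.sum_congr rfl fun i _ => ?_
  have := mem_biasInterval_congr ha hb h i
  by_cases hi : a ∈ biasInterval t i
  · rw [if_pos hi, if_pos (this.1 hi)]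
  · rw [if_neg hi, if_neg (mt this.2 hi)]

/-- The expected contribution of an edge to the rounded cut, when its end points have biases
`a` and `b`. -/
def edgeWeight {ℓ : ℕ} (t r : Fin ℓ → ℝ) (a b : ℝ) : ℝ :=
  intervalWeight t r a * intervalWeight t (1 - r) b

lemma one_sub_mem {ℓ : ℕ} {r : Fin ℓ → ℝ} (hr : ∀ i, r i ∈ Set.Icc (0 : ℝ) 1) (i : Fin ℓ) :
    (1 - r) i ∈ Set.Icc (0 : ℝ) 1 := by
  have := hr i
  simp only [Pi.sub_apply, Pi.one_apply, Set.mem_Icc] at *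
  constructor <;> linarith

lemma edgeWeight_nonneg {ℓ : ℕ} (t : Fin ℓ → ℝ) {r : Fin ℓ → ℝ} (hr : ∀ i, r i ∈ Set.Icc (0 : ℝ) 1)
    (a b : ℝ) : 0 ≤ edgeWeight t r a b :=
  mul_nonneg (intervalWeight_nonneg t hr a) (intervalWeight_nonneg t (one_sub_mem hr) b)

lemma edgeWeight_le {ℓ : ℕ} (t : Fin ℓ → ℝ) {r : Fin ℓ → ℝ} (hr : ∀ i, r i ∈ Set.Icc (0 : ℝ) 1)
    (a b : ℝ) : edgeWeight t r a b ≤ (ℓ : ℝ) ^ 2 := by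
  rw [sq]
  exact mul_le_mul (intervalWeight_le t hr a) (intervalWeight_le t (one_sub_mem hr) b)
    (intervalWeight_nonneg t (one_sub_mem hr) b) (Nat.cast_nonneg _)

-- The values `f e` and `g e` may depend on the whole edge, so that snapshots and pseudosnapshots
-- are both covered.
open scoped Classical in
lemma cutValue_edgeCount {α : Type*} {ℓ : ℕ} (t r : Fin ℓ → ℝ) (s : Finset α) (f g : α → ℝ) :
    cutValue r (Matrix.of fun i j => (s.filter fun e =>
      f e ∈ biasInterval t i ∧ g e ∈ biasInterval t j).card) =
      ∑ e ∈ s, edgeWeight t r (f e) (g e) := by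
  simp only [cutValue, dotProduct, Matrix.mulVec, Matrix.map_apply, Matrix.of_apply, edgeWeight,
    intervalWeight, Finset.card_filter, Nat.cast_sum]
  simp only [Finset.sum_mul_sum]
  rw [Finset.sum_comm]
  refine Finset.sum_congr rfl fun i _ => ?_
  rw [Finset.sum_comm, Finset.mul_sum]
  refine Finset.sum_congr rfl fun j _ => ?_
  rw [Finset.sum_mul, Finset.mul_sum]
  refine Finset.sum_congr rfl fun e _ => ?_
  by_cases h1 : f e ∈ biasInterval t i <;> by_cases h2 : g e ∈ biasInterval t j <;> simp [h1, h2]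

lemma cutValue_snapshot {V : Type} [DecidableEq V] {ℓ : ℕ} (t r : Fin ℓ → ℝ) (G : SimpleDigraph V) :
    cutValue r (snapshot t G) = ∑ e ∈ G.edges, edgeWeight t r (G.bias e.1) (G.bias e.2) :=
  cutValue_edgeCount t r G.edges (fun e => G.bias e.1) (fun e => G.bias e.2)

lemma cutValue_pseudosnapshot {V : Type} [DecidableEq V] {ℓ : ℕ} (t r : Fin ℓ → ℝ)
    (G : SimpleDigraph V) (τ : V × V → ℕ) (N : ℕ) (ε κ : ℝ) (ω : HashOutcome V N ε) :
    cutValue r (pseudosnapshot t G τ N ε κ ω) = ∑ e ∈ G.edges,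
      edgeWeight t r (pseudobias G τ N ε κ ω e e.1) (pseudobias G τ N ε κ ω e e.2) :=
  cutValue_edgeCount t r G.edges (fun e => pseudobias G τ N ε κ ω e e.1)
    (fun e => pseudobias G τ N ε κ ω e e.2)

end Rounding

/-! ### Degree sums, cuts and fractional cuts. -/

namespace SimpleDigraph

variable {V : Type} [DecidableEq V]

lemma degree_eq_add (G : SimpleDigraph V) (v : V) : G.degree v = G.outDegree v + G.inDegree v := by
  rw [degree, Finset.filter_or, Finset.card_union_of_disjoint, outDegree, inDegree]
  refine Finset.disjoint_filter.2 fun e he h1 h2 => G.loopless e he (h1.trans h2.symm)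

lemma sum_head [Fintype V] (G : SimpleDigraph V) (f : V → ℝ) :
    ∑ e ∈ G.edges, f e.1 = ∑ v, G.outDegree v * f v := by
  rw [← Finset.sum_fiberwise (g := Prod.fst)]
  refine Finset.sum_congr rfl fun v _ => ?_
  rw [Finset.sum_congr rfl (g := fun _ => f v) (by simp +contextual), Finset.sum_const,
    nsmul_eq_mul, outDegree]

lemma sum_tail [Fintype V] (G : SimpleDigraph V) (f : V → ℝ) :
    ∑ e ∈ G.edges, f e.2 = ∑ v, G.inDegree v * f v := by
  rw [← Finset.sum_fiberwise (g := Prod.snd)]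
  refine Finset.sum_congr rfl fun v _ => ?_
  rw [Finset.sum_congr rfl (g := fun _ => f v) (by simp +contextual), Finset.sum_const,
    nsmul_eq_mul, inDegree]

/-- The number of edges cut by `x`, as a sum over edges. -/
def cutSize (G : SimpleDigraph V) (x : V → Bool) : ℝ :=
  ∑ e ∈ G.edges, (if x e.1 = false then 1 else 0) * (if x e.2 = true then 1 else 0)

lemma cutSize_eq (G : SimpleDigraph V) (x : V → Bool) :
    G.cutSize x = (G.edges.filter fun e => x e.1 = false ∧ x e.2 = true).card := by
  rw [cutSize, Finset.card_filter, Nat.cast_sum]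
  refine Finset.sum_congr rfl fun e _ => ?_
  by_cases h1 : x e.1 = false <;> by_cases h2 : x e.2 = true <;> simp [h1, h2]

lemma cutSize_le_maxDicut [Fintype V] (G : SimpleDigraph V) (x : V → Bool) :
    G.cutSize x ≤ G.maxDicut := by
  rw [cutSize_eq]
  exact_mod_cast Finset.le_sup
    (f := fun x : V → Bool => (G.edges.filter fun e => x e.1 = false ∧ x e.2 = true).card)
    (Finset.mem_univ x)

lemma exists_cutSize_eq_maxDicut [Fintype V] (G : SimpleDigraph V) :
    ∃ x, G.cutSize x = G.maxDicut := by
  obtain ⟨x, -, hx⟩ := Finset.exists_mem_eq_sup (Finset.univ : Finset (V → Bool))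
    ⟨fun _ => true, Finset.mem_univ _⟩
    (fun x : V → Bool => (G.edges.filter fun e => x e.1 = false ∧ x e.2 = true).card)
  exact ⟨x, by rw [cutSize_eq, maxDicut, hx]⟩

end SimpleDigraph

/-- Two coordinates of a uniformly random function are independent. -/
lemma sum_pi_mul_eval {V ι : Type*} [Fintype V] [DecidableEq V] [Fintype ι] {u v : V} (huv : u ≠ v)
    (f g : V → ι → ℝ) :
    (Fintype.card ι : ℝ) ^ 2 * ∑ φ : V → ι, f u (φ u) * g v (φ v) =
      (Fintype.card (V → ι) : ℝ) * ((∑ i, f u i) * ∑ i, g v i) := by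
  classical
  -- The factors at vertices other than `u` and `v` are `1`, so expanding the product of sums yields
  -- the sum over all `φ`.
  have key := Finset.prod_univ_sum (fun _ : V => (Finset.univ : Finset ι))
    (fun w i => if w = u then f u i else if w = v then g v i else (1 : ℝ))
  have h1 : ∀ φ : V → ι, ∏ w, (if w = u then f u (φ w) else if w = v then g v (φ w) else (1 : ℝ)) =
      f u (φ u) * g v (φ v) := fun φ => by
    rw [← Finset.mul_prod_erase _ _ (Finset.mem_univ u),
      ← Finset.mul_prod_erase _ _ (Finset.mem_erase.2 ⟨huv.symm, Finset.mem_univ v⟩)]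
    rw [Finset.prod_eq_one]
    · simp [huv.symm]
    · intro w hw
      simp only [Finset.mem_erase] at hw
      simp [hw.1, hw.2.1]
  have h2 : ∏ w, ∑ i, (if w = u then f u i else if w = v then g v i else (1 : ℝ)) =
      (∑ i, f u i) * ((∑ i, g v i) * (Fintype.card ι : ℝ) ^ (Fintype.card V - 2)) := by
    rw [← Finset.mul_prod_erase _ _ (Finset.mem_univ u),
      ← Finset.mul_prod_erase _ _ (Finset.mem_erase.2 ⟨huv.symm, Finset.mem_univ v⟩)]
    rw [Finset.prod_congr rfl (g := fun _ => (Fintype.card ι : ℝ))]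
    · rw [Finset.prod_const, Finset.card_erase_of_mem (by simp [huv.symm]),
        Finset.card_erase_of_mem (Finset.mem_univ _), Finset.card_univ, Nat.sub_sub]
      simp [huv.symm]
    · intro w hw
      simp only [Finset.mem_erase] at hw
      simp [hw.1, hw.2.1]
  rw [h2] at key
  simp only [Fintype.piFinset_univ, h1] at key
  rw [← key]
  have hc : 2 ≤ Fintype.card V := Fintype.one_lt_card_iff.2 ⟨u, v, huv⟩
  have : (Fintype.card (V → ι) : ℝ) = (Fintype.card ι : ℝ) ^ 2 * (Fintype.card ι : ℝ) ^ (Fintype.card V - 2) := by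
    rw [← pow_add, Fintype.card_fun, Nat.cast_pow]
    congr 1
    omega
  rw [this]
  ring

namespace SimpleDigraph

variable {V : Type} [DecidableEq V]

/-- Fractional cuts do not beat integral ones. -/
lemma sum_fractional_cut_le {ι : Type*} [Fintype V] [Fintype ι] [Nonempty ι] (G : SimpleDigraph V)
    (x : V → ι → Bool) :
    ∑ e ∈ G.edges, (∑ i, if x e.1 i = false then (1 : ℝ) else 0) *
        (∑ j, if x e.2 j = true then (1 : ℝ) else 0) ≤
      (Fintype.card ι : ℝ) ^ 2 * G.maxDicut := by
  have hpos : (0 : ℝ) < Fintype.card (V → ι) := by exact_mod_cast Fintype.card_pos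
  refine le_of_mul_le_mul_left ?_ hpos
  -- Choosing one of the values `x v i` at every vertex gives an integral cut; the fractional cut is
  -- the average over all choices, since the ends of an edge are distinct.
  have h : ∑ φ : V → ι, G.cutSize (fun v => x v (φ v)) ≤ Fintype.card (V → ι) * (G.maxDicut : ℝ) := by
    calc _ ≤ ∑ _φ : V → ι, (G.maxDicut : ℝ) := Finset.sum_le_sum fun φ _ => G.cutSize_le_maxDicut _
      _ = _ := by simp
  calc _ = ∑ e ∈ G.edges, (Fintype.card ι : ℝ) ^ 2 * ∑ φ : V → ι,
          (if x e.1 (φ e.1) = false then (1 : ℝ) else 0) * (if x e.2 (φ e.2) = true then 1 else 0) := by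
        rw [Finset.mul_sum]
        refine Finset.sum_congr rfl fun e he => ?_
        exact (sum_pi_mul_eval (G.loopless e he) (fun v i => if x v i = false then (1 : ℝ) else 0)
          (fun v i => if x v i = true then (1 : ℝ) else 0)).symm
    _ = (Fintype.card ι : ℝ) ^ 2 * ∑ φ : V → ι, G.cutSize (fun v => x v (φ v)) := by
        simp only [cutSize]
        rw [← Finset.mul_sum, Finset.sum_comm]
    _ ≤ _ := by
        rw [mul_left_comm]
        gcongr

/-- A uniformly random bipartition cuts each edge with probability `1/4`. -/
lemma numEdges_le [Fintype V] (G : SimpleDigraph V) : (G.numEdges : ℝ) ≤ 4 * G.maxDicut := by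
  have := G.sum_fractional_cut_le (fun _ b => b)
  norm_num [numEdges] at this ⊢
  exact this

end SimpleDigraph

/-! ### Blow-ups with flipped half-edges -/

/-- The vertices of the flipped blow-up: `M` copies of every vertex, and one additional vertex for
every copy of an edge. -/
abbrev BlowupVertex (V : Type) (M : ℕ) : Type := (V × Fin M) ⊕ ((V × V) × (Fin M × Fin M))

section Blowup

variable {V : Type} {M : ℕ}

/-- The head half of the edge copy `p` is flipped. -/
abbrev HeadFlipped (h : V → ℕ) (p : (V × V) × (Fin M × Fin M)) : Prop := (p.2.2 : ℕ) < h p.1.1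

/-- The tail half of the edge copy `p` is flipped. -/
abbrev TailFlipped (k : V → ℕ) (p : (V × V) × (Fin M × Fin M)) : Prop := (p.2.1 : ℕ) < k p.1.2

/-- The copy of the head of an edge copy. -/
abbrev headCopy (p : (V × V) × (Fin M × Fin M)) : BlowupVertex V M := Sum.inl (p.1.1, p.2.1)

/-- The copy of the tail of an edge copy. -/
abbrev tailCopy (p : (V × V) × (Fin M × Fin M)) : BlowupVertex V M := Sum.inl (p.1.2, p.2.2)

/-- The edge that replaces the head half of an edge copy. -/
def headHalf (h : V → ℕ) (p : (V × V) × (Fin M × Fin M)) : BlowupVertex V M × BlowupVertex V M :=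
  if HeadFlipped h p then (Sum.inr p, headCopy p) else (headCopy p, Sum.inr p)

/-- The edge that replaces the tail half of an edge copy. -/
def tailHalf (k : V → ℕ) (p : (V × V) × (Fin M × Fin M)) : BlowupVertex V M × BlowupVertex V M :=
  if TailFlipped k p then (tailCopy p, Sum.inr p) else (Sum.inr p, tailCopy p)

variable [DecidableEq V]

/-- The edges that replace an edge copy: the copy itself, if none of its halves is flipped, and
otherwise two half-edges, each of them flipped or not, that meet in the additional vertex. -/
def gadget (h k : V → ℕ) (p : (V × V) × (Fin M × Fin M)) :
    Finset (BlowupVertex V M × BlowupVertex V M) :=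
  if HeadFlipped h p ∨ TailFlipped k p then {headHalf h p, tailHalf k p}
  else {(headCopy p, tailCopy p)}

/-- The edge copy whose gadget may contain a given pair of vertices. -/
def gadgetOwner : BlowupVertex V M × BlowupVertex V M → Option ((V × V) × (Fin M × Fin M))
  | (Sum.inl w, Sum.inl z) => some ((w.1, z.1), (w.2, z.2))
  | (Sum.inl _, Sum.inr p) => some p
  | (Sum.inr p, _) => some p

/-- This makes the gadgets of different edge copies disjoint: a subdividing vertex names its copy,
and an unsubdivided copy is determined by its end points. -/
lemma gadgetOwner_eq {h k : V → ℕ} {p : (V × V) × (Fin M × Fin M)}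
    {a : BlowupVertex V M × BlowupVertex V M} (ha : a ∈ gadget h k p) : gadgetOwner a = some p := by
  unfold gadget headHalf tailHalf at ha
  split_ifs at ha <;> simp only [Finset.mem_insert, Finset.mem_singleton] at ha
  all_goals rcases ha with rfl | rfl <;> rfl

lemma fst_ne_snd_of_mem_gadget {h k : V → ℕ} {p : (V × V) × (Fin M × Fin M)} (hp : p.1.1 ≠ p.1.2)
    {a : BlowupVertex V M × BlowupVertex V M} (ha : a ∈ gadget h k p) : a.1 ≠ a.2 := by
  unfold gadget headHalf tailHalf at ha
  split_ifs at ha <;> simp only [Finset.mem_insert, Finset.mem_singleton] at ha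
  all_goals rcases ha with rfl | rfl <;> simp [hp]

lemma sum_gadget {h k : V → ℕ} {p : (V × V) × (Fin M × Fin M)} (hp : p.1.1 ≠ p.1.2)
    (F : BlowupVertex V M × BlowupVertex V M → ℝ) :
    ∑ a ∈ gadget h k p, F a = if HeadFlipped h p ∨ TailFlipped k p then
      F (headHalf h p) + F (tailHalf k p) else F (headCopy p, tailCopy p) := by
  unfold gadget
  split_ifs with hf
  · refine Finset.sum_pair ?_
    unfold headHalf tailHalf
    split_ifs <;> simp [hp]
  · simp

namespace SimpleDigraph

/-- The blow-up of `G` in which the head halves of `h v` out of `M` and the tail halves of `k v`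
out of `M` edges at every copy of a vertex `v` are flipped. -/
def flippedBlowup (G : SimpleDigraph V) (M : ℕ) (h k : V → ℕ) : SimpleDigraph (BlowupVertex V M) where
  edges := (G.edges ×ˢ Finset.univ).biUnion (gadget h k)
  loopless a ha := by
    obtain ⟨p, hp, ha⟩ := Finset.mem_biUnion.1 ha
    exact fst_ne_snd_of_mem_gadget (G.loopless _ (Finset.mem_product.1 hp).1) ha

lemma sum_flippedBlowup (G : SimpleDigraph V) (h k : V → ℕ)
    (F : BlowupVertex V M × BlowupVertex V M → ℝ) :
    ∑ a ∈ (G.flippedBlowup M h k).edges, F a = ∑ p ∈ G.edges ×ˢ (Finset.univ : Finset (Fin M × Fin M)),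
      if HeadFlipped h p ∨ TailFlipped k p then
        F (headHalf h p) + F (tailHalf k p) else F (headCopy p, tailCopy p) := by
  rw [flippedBlowup, Finset.sum_biUnion]
  · exact Finset.sum_congr rfl fun p hp => sum_gadget (G.loopless _ (Finset.mem_product.1 hp).1) F
  · intro p _ q _ hpq
    refine Finset.disjoint_left.2 fun a ha hb => hpq ?_
    exact Option.some.inj ((gadgetOwner_eq ha).symm.trans (gadgetOwner_eq hb))

lemma card_fin_lt {M k : ℕ} (hk : k ≤ M) : ∑ i : Fin M, (if (i : ℕ) < k then (1 : ℝ) else 0) = k := by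
  rw [Fin.sum_univ_eq_sum_range (fun i => if i < k then (1 : ℝ) else 0), Finset.sum_ite]
  simp only [Finset.sum_const, nsmul_eq_mul, mul_one, mul_zero, add_zero]
  congr 1
  rw [show (Finset.range M).filter (· < k) = Finset.range k by ext; simp; omega, Finset.card_range]

lemma card_fin_not_lt {M k : ℕ} (hk : k ≤ M) :
    ∑ i : Fin M, (if (i : ℕ) < k then (0 : ℝ) else 1) = M - k := by
  rw [eq_sub_iff_add_eq, ← card_fin_lt hk, ← Finset.sum_add_distrib,
    Finset.sum_congr rfl (g := fun _ => (1 : ℝ)) (fun i _ => by split_ifs <;> simp)]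
  simp

lemma sum_edges_ite_fst (G : SimpleDigraph V) (v : V) (c : ℝ) :
    ∑ e ∈ G.edges, (if e.1 = v then c else 0) = G.outDegree v * c := by
  rw [← Finset.sum_filter, Finset.sum_const, nsmul_eq_mul, outDegree]

lemma sum_edges_ite_snd (G : SimpleDigraph V) (v : V) (c : ℝ) :
    ∑ e ∈ G.edges, (if e.2 = v then c else 0) = G.inDegree v * c := by
  rw [← Finset.sum_filter, Finset.sum_const, nsmul_eq_mul, inDegree]

/-- Whether the half at one end is flipped depends on the copy index of the other end. Every copy of
`v` therefore sees exactly `h v` of the `M` copies of each out-edge flipped, and `k v` of the `M`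
copies of each in-edge. -/
lemma outDegree_flippedBlowup (G : SimpleDigraph V) {h k : V → ℕ} {v : V} (hh : h v ≤ M)
    (hk : k v ≤ M) (a : Fin M) : ((G.flippedBlowup M h k).outDegree (Sum.inl (v, a)) : ℝ) =
      G.outDegree v * (M - h v) + G.inDegree v * k v := by
  have h0 := (G.flippedBlowup M h k).sum_edges_ite_fst (Sum.inl (v, a)) 1
  rw [mul_one, sum_flippedBlowup] at h0
  rw [← h0]
  have h1 : ∀ p : (V × V) × (Fin M × Fin M),
      (if HeadFlipped h p ∨ TailFlipped k p then
        (if (headHalf h p).1 = Sum.inl (v, a) then (1 : ℝ) else 0) +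
          (if (tailHalf k p).1 = Sum.inl (v, a) then (1 : ℝ) else 0)
      else (if (headCopy p, tailCopy p).1 = Sum.inl (v, a) then (1 : ℝ) else 0)) =
      (if p.1.1 = v then (if p.2.1 = a then (if (p.2.2 : ℕ) < h p.1.1 then (0 : ℝ) else 1) else 0) else 0) +
      (if p.1.2 = v then (if p.2.2 = a then (if (p.2.1 : ℕ) < k p.1.2 then (1 : ℝ) else 0) else 0) else 0) := by
    rintro ⟨⟨u, w⟩, i, j⟩
    by_cases c1 : (j : ℕ) < h u <;> by_cases c2 : (i : ℕ) < k w <;>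
    simp [headHalf, tailHalf, c1, c2, ite_and]
  rw [Finset.sum_congr rfl fun p _ => h1 p, Finset.sum_add_distrib, Finset.sum_product,
    Finset.sum_product]
  congr 1
  · rw [← card_fin_not_lt hh, ← sum_edges_ite_fst]
    refine Finset.sum_congr rfl fun e _ => ?_
    simp only [← Finset.univ_product_univ, Finset.sum_product]
    split_ifs with hv
    · rw [Finset.sum_eq_single a (by simp +contextual) (by simp)]
      simp [hv]
    · simp
  · rw [← card_fin_lt hk, ← sum_edges_ite_snd]
    refine Finset.sum_congr rfl fun e _ => ?_
    simp only [← Finset.univ_product_univ, Finset.sum_product_right]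
    split_ifs with hv
    · rw [Finset.sum_eq_single a (by simp +contextual) (by simp)]
      simp [hv]
    · simp

lemma inDegree_flippedBlowup (G : SimpleDigraph V) {h k : V → ℕ} {v : V} (hh : h v ≤ M)
    (hk : k v ≤ M) (a : Fin M) : ((G.flippedBlowup M h k).inDegree (Sum.inl (v, a)) : ℝ) =
      G.outDegree v * h v + G.inDegree v * (M - k v) := by
  have h0 := (G.flippedBlowup M h k).sum_edges_ite_snd (Sum.inl (v, a)) 1
  rw [mul_one, sum_flippedBlowup] at h0
  rw [← h0]
  have h1 : ∀ p : (V × V) × (Fin M × Fin M),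
      (if HeadFlipped h p ∨ TailFlipped k p then
        (if (headHalf h p).2 = Sum.inl (v, a) then (1 : ℝ) else 0) +
          (if (tailHalf k p).2 = Sum.inl (v, a) then (1 : ℝ) else 0)
      else (if (headCopy p, tailCopy p).2 = Sum.inl (v, a) then (1 : ℝ) else 0)) =
      (if p.1.1 = v then (if p.2.1 = a then (if (p.2.2 : ℕ) < h p.1.1 then (1 : ℝ) else 0) else 0) else 0) +
      (if p.1.2 = v then (if p.2.2 = a then (if (p.2.1 : ℕ) < k p.1.2 then (0 : ℝ) else 1) else 0) else 0) := by
    rintro ⟨⟨u, w⟩, i, j⟩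
    by_cases c1 : (j : ℕ) < h u <;> by_cases c2 : (i : ℕ) < k w <;>
    simp [headHalf, tailHalf, c1, c2, ite_and]
  rw [Finset.sum_congr rfl fun p _ => h1 p, Finset.sum_add_distrib, Finset.sum_product,
    Finset.sum_product]
  congr 1
  · rw [← card_fin_lt hh, ← sum_edges_ite_fst]
    refine Finset.sum_congr rfl fun e _ => ?_
    simp only [← Finset.univ_product_univ, Finset.sum_product]
    split_ifs with hv
    · rw [Finset.sum_eq_single a (by simp +contextual) (by simp)]
      simp [hv]
    · simp
  · rw [← card_fin_not_lt hk, ← sum_edges_ite_snd]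
    refine Finset.sum_congr rfl fun e _ => ?_
    simp only [← Finset.univ_product_univ, Finset.sum_product_right]
    split_ifs with hv
    · rw [Finset.sum_eq_single a (by simp +contextual) (by simp)]
      simp [hv]
    · simp

lemma bias_mul_degree (G : SimpleDigraph V) (v : V) :
    G.bias v * G.degree v = G.outDegree v - G.inDegree v := by
  unfold bias
  rcases Nat.eq_zero_or_pos (G.degree v) with h0 | h0
  · have h1 := G.degree_eq_add v
    have h2 : G.outDegree v = 0 := by omega
    have h3 : G.inDegree v = 0 := by omega
    simp [h0, h2, h3]
  · field_simp

/-- Flips preserve the total degree `M * G.degree v` of a copy. Isolated vertices are excluded: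
their bias is `0` by the convention on division, whatever `h` and `k` are. -/
lemma bias_flippedBlowup (G : SimpleDigraph V) {h k : V → ℕ} {v : V} (hh : h v ≤ M)
    (hk : k v ≤ M) (a : Fin M) (hv : G.degree v ≠ 0) :
    (G.flippedBlowup M h k).bias (Sum.inl (v, a)) =
      G.bias v - h v / M * (1 + G.bias v) + k v / M * (1 - G.bias v) := by
  have hM : (M : ℝ) ≠ 0 := by exact_mod_cast (a.pos).ne'
  have hd : (G.degree v : ℝ) ≠ 0 := by exact_mod_cast hv
  have h1 := G.bias_mul_degree v
  have h2 : (G.degree v : ℝ) = G.outDegree v + G.inDegree v := by exact_mod_cast G.degree_eq_add v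
  rw [bias, degree_eq_add, Nat.cast_add, outDegree_flippedBlowup G hh hk,
    inDegree_flippedBlowup G hh hk]
  have ho : (G.outDegree v : ℝ) = G.degree v * (1 + G.bias v) / 2 := by linarith
  have hi : (G.inDegree v : ℝ) = G.degree v * (1 - G.bias v) / 2 := by linarith
  have hden : (G.outDegree v * (M - h v) + G.inDegree v * k v +
      (G.outDegree v * h v + G.inDegree v * (M - k v)) : ℝ) = G.degree v * M := by rw [h2]; ring
  rw [hden, ho, hi]
  field_simp
  ring

end SimpleDigraph

end Blowup

/-! ### Cuts and biases of the flipped blow-up -/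

/-- Flipping an integral number out of `M` equal parts of the out- or of the in-edges moves a bias
`b` up to `2 / M` to any given `β`. -/
lemma exists_flips {b β : ℝ} (hb : b ∈ Set.Icc (-1 : ℝ) 1) (hβ : β ∈ Set.Icc (-1 : ℝ) 1) {M : ℕ}
    (hM : 0 < M) : ∃ h ≤ M, ∃ k ≤ M, β ≤ b - h / M * (1 + b) + k / M * (1 - b) ∧
      b - h / M * (1 + b) + k / M * (1 - b) ≤ β + 2 / M ∧
      (1 + b) / 2 * h + (1 - b) / 2 * k ≤ M * |β - b| / 2 + 1 := by
  obtain ⟨hb1, hb2⟩ := hb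
  obtain ⟨hβ1, hβ2⟩ := hβ
  have hM' : (0 : ℝ) < M := by exact_mod_cast hM
  rcases le_or_gt b β with hle | hlt
  -- Raising the bias means flipping a fraction `s` of the in-edges, rounded up. For `b = 1` there
  -- are none, but then `β = 1` as well.
  · rcases hb2.eq_or_lt with rfl | hb2
    · refine ⟨0, hM.le, 0, hM.le, ?_, ?_, ?_⟩
      · simpa using hβ2
      · have : 0 < 2 / (M : ℝ) := by positivity
        simp; linarith
      · simp; positivity
    have hb : 0 < 1 - b := by linarith
    set s := (β - b) / (1 - b) with hs
    have hsb : s * (1 - b) = β - b := by rw [hs]; field_simp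
    have hs0 : 0 ≤ s := div_nonneg (by linarith) hb.le
    have hs1 : s ≤ 1 := by rw [hs, div_le_one hb]; linarith
    have hk1 : s * M ≤ ⌈s * M⌉₊ := Nat.le_ceil _
    have hk2 : (⌈s * M⌉₊ : ℝ) < s * M + 1 := Nat.ceil_lt_add_one (by positivity)
    have hd1 : s ≤ ⌈s * M⌉₊ / M := by rwa [le_div_iff₀ hM']
    have hd2 : (⌈s * M⌉₊ : ℝ) / M ≤ s + 1 / M := by
      rw [div_le_iff₀ hM', add_mul, one_div, inv_mul_cancel₀ hM'.ne']
      exact hk2.le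
    refine ⟨0, hM.le, ⌈s * M⌉₊, ?_, ?_, ?_, ?_⟩
    · refine Nat.ceil_le.2 ?_
      nlinarith
    · have := mul_le_mul_of_nonneg_right hd1 hb.le
      simp only [Nat.cast_zero, zero_div, zero_mul, sub_zero]
      linarith
    · have h1 := mul_le_mul_of_nonneg_right hd2 hb.le
      have h2 : 1 / (M : ℝ) * (1 - b) ≤ 1 / M * 2 := by gcongr; linarith
      have h3 : 1 / (M : ℝ) * 2 = 2 / M := by ring
      simp only [Nat.cast_zero, zero_div, zero_mul, sub_zero]
      linarith [add_mul s (1 / (M : ℝ)) (1 - b)]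
    · rw [abs_of_nonneg (by linarith), ← hsb]
      simp only [Nat.cast_zero, mul_zero, zero_add]
      nlinarith
  -- Lowering the bias flips out-edges, rounded down, so that the result again lies on the upper
  -- side of `β`, the side on which intervals are closed.
  · have hb : 0 < 1 + b := by linarith
    set s := (b - β) / (1 + b) with hs
    have hsb : s * (1 + b) = b - β := by rw [hs]; field_simp
    have hs0 : 0 ≤ s := div_nonneg (by linarith) hb.le
    have hs1 : s ≤ 1 := by rw [hs, div_le_one hb]; linarith
    have hk1 : (⌊s * M⌋₊ : ℝ) ≤ s * M := Nat.floor_le (by positivity)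
    have hk2 : s * M < (⌊s * M⌋₊ : ℝ) + 1 := Nat.lt_floor_add_one _
    have hd1 : (⌊s * M⌋₊ : ℝ) / M ≤ s := by rwa [div_le_iff₀ hM']
    have hd2 : s ≤ (⌊s * M⌋₊ : ℝ) / M + 1 / M := by
      rw [← add_div, le_div_iff₀ hM']
      exact hk2.le
    refine ⟨⌊s * M⌋₊, ?_, 0, hM.le, ?_, ?_, ?_⟩
    · have : (⌊s * M⌋₊ : ℝ) ≤ M := by nlinarith
      exact_mod_cast this
    · have := mul_le_mul_of_nonneg_right hd1 hb.le
      simp only [Nat.cast_zero, zero_div, zero_mul, add_zero]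
      linarith
    · have h1 := mul_le_mul_of_nonneg_right hd2 hb.le
      have h2 : 1 / (M : ℝ) * (1 + b) ≤ 1 / M * 2 := by gcongr; linarith
      have h3 : 1 / (M : ℝ) * 2 = 2 / M := by ring
      simp only [Nat.cast_zero, zero_div, zero_mul, add_zero]
      linarith [add_mul ((⌊s * M⌋₊ : ℝ) / M) (1 / (M : ℝ)) (1 + b)]
    · rw [abs_of_nonpos (by linarith), neg_sub, ← hsb]
      simp only [Nat.cast_zero, mul_zero, add_zero]
      nlinarith

namespace SimpleDigraph

variable {V : Type} [DecidableEq V]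

lemma bias_mem_Icc (G : SimpleDigraph V) (v : V) : G.bias v ∈ Set.Icc (-1 : ℝ) 1 := by
  have h1 := G.bias_mul_degree v
  have h2 : (G.degree v : ℝ) = G.outDegree v + G.inDegree v := by exact_mod_cast G.degree_eq_add v
  have ho : (0 : ℝ) ≤ G.outDegree v := Nat.cast_nonneg _
  have hi : (0 : ℝ) ≤ G.inDegree v := Nat.cast_nonneg _
  rcases (Nat.cast_nonneg (α := ℝ) (G.degree v)).eq_or_lt with h0 | h0
  · simp [bias, ← h0]
  · constructor
    · refine le_of_mul_le_mul_right ?_ h0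
      linarith
    · refine le_of_mul_le_mul_right ?_ h0
      linarith

lemma degree_pos_of_mem (G : SimpleDigraph V) {e : V × V} (he : e ∈ G.edges) {v : V}
    (hv : e.1 = v ∨ e.2 = v) : 0 < G.degree v :=
  Finset.card_pos.2 ⟨e, Finset.mem_filter.2 ⟨he, hv⟩⟩

variable {M : ℕ}

/-- The number of edge copies with a flipped half. -/
def flippedCount (G : SimpleDigraph V) (M : ℕ) (h k : V → ℕ) : ℝ :=
  ∑ p ∈ G.edges ×ˢ (Finset.univ : Finset (Fin M × Fin M)),
    if HeadFlipped h p ∨ TailFlipped k p then (1 : ℝ) else 0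

/-- Only copies with a flipped half contribute to the difference: two half-edges, of total weight at
most `2 * L`, stand against one edge of weight at most `L`. -/
lemma abs_sum_flippedBlowup_sub_le (G : SimpleDigraph V) (h k : V → ℕ)
    {F : BlowupVertex V M × BlowupVertex V M → ℝ} {L : ℝ} (hF0 : ∀ a, 0 ≤ F a) (hF1 : ∀ a, F a ≤ L) :
    |∑ a ∈ (G.flippedBlowup M h k).edges, F a -
      ∑ p ∈ G.edges ×ˢ (Finset.univ : Finset (Fin M × Fin M)), F (headCopy p, tailCopy p)| ≤
      2 * L * G.flippedCount M h k := by
  rw [sum_flippedBlowup, ← Finset.sum_sub_distrib, flippedCount, Finset.mul_sum]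
  refine (Finset.abs_sum_le_sum_abs _ _).trans (Finset.sum_le_sum fun p _ => ?_)
  split_ifs
  · have a1 := hF0 (headHalf h p)
    have a2 := hF1 (headHalf h p)
    have b1 := hF0 (tailHalf k p)
    have b2 := hF1 (tailHalf k p)
    have c1 := hF0 (headCopy p, tailCopy p)
    have c2 := hF1 (headCopy p, tailCopy p)
    rw [abs_le]
    constructor <;> linarith
  · simp

variable [Fintype V]

lemma sum_degree (G : SimpleDigraph V) : ∑ v, (G.degree v : ℝ) = 2 * G.numEdges := by
  have h1 := G.sum_head fun _ => 1
  have h2 := G.sum_tail fun _ => 1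
  simp only [Finset.sum_const, nsmul_eq_mul, mul_one] at h1 h2
  simp only [degree_eq_add, Nat.cast_add, Finset.sum_add_distrib]
  rw [← h1, ← h2, numEdges]
  ring

lemma flippedCount_le (G : SimpleDigraph V) {h k : V → ℕ} (hh : ∀ v, h v ≤ M) (hk : ∀ v, k v ≤ M) :
    G.flippedCount M h k ≤ M * ∑ v, (G.outDegree v * h v + G.inDegree v * k v : ℝ) := by
  have h1 : G.flippedCount M h k ≤ ∑ e ∈ G.edges, ∑ i : Fin M, ∑ j : Fin M,
      ((if (j : ℕ) < h e.1 then (1 : ℝ) else 0) + if (i : ℕ) < k e.2 then (1 : ℝ) else 0) := by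
    simp only [flippedCount, Finset.sum_product, ← Finset.univ_product_univ]
    refine Finset.sum_le_sum fun e _ => Finset.sum_le_sum fun i _ => Finset.sum_le_sum fun j _ => ?_
    by_cases c1 : (j : ℕ) < h e.1 <;> by_cases c2 : (i : ℕ) < k e.2 <;> simp [c1, c2]
  refine h1.trans_eq ?_
  simp only [Finset.sum_add_distrib, Finset.sum_const, card_fin_lt (hh _), Finset.card_univ,
    Fintype.card_fin, nsmul_eq_mul, ← Finset.mul_sum, card_fin_lt (hk _)]
  rw [G.sum_head fun v => (h v : ℝ), G.sum_tail fun v => (k v : ℝ)]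
  ring

/-- On the unsubdivided copies, a cut of the blow-up is a fractional cut of `G`: a vertex takes the
average of the sides of its copies. -/
lemma maxDicut_flippedBlowup_le [Nonempty (Fin M)] (G : SimpleDigraph V) (h k : V → ℕ) :
    ((G.flippedBlowup M h k).maxDicut : ℝ) ≤ M ^ 2 * G.maxDicut + 2 * G.flippedCount M h k := by
  obtain ⟨x, hx⟩ := (G.flippedBlowup M h k).exists_cutSize_eq_maxDicut
  rw [← hx]
  have h1 := (abs_le.1 (G.abs_sum_flippedBlowup_sub_le (M := M) h k (L := 1)
    (F := fun a => (if x a.1 = false then 1 else 0) * (if x a.2 = true then 1 else 0))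
    (fun a => by positivity) (fun a => by split_ifs <;> simp))).2
  have h2 := G.sum_fractional_cut_le fun v (i : Fin M) => x (Sum.inl (v, i))
  simp only [Finset.sum_product, ← Finset.univ_product_univ, Finset.sum_mul_sum,
    Fintype.card_fin] at h1 h2
  rw [cutSize]
  linarith

/-- An optimal cut of `G` is lifted to the copies. The side of the subdividing vertices is
irrelevant, as the copies that contain them are given up. -/
lemma le_maxDicut_flippedBlowup (G : SimpleDigraph V) (h k : V → ℕ) :
    M ^ 2 * (G.maxDicut : ℝ) - 2 * G.flippedCount M h k ≤ (G.flippedBlowup M h k).maxDicut := by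
  obtain ⟨x, hx⟩ := G.exists_cutSize_eq_maxDicut
  let y : BlowupVertex V M → Bool := Sum.elim (fun w => x w.1) fun _ => false
  refine le_trans ?_ ((G.flippedBlowup M h k).cutSize_le_maxDicut y)
  have h1 := (abs_le.1 (G.abs_sum_flippedBlowup_sub_le (M := M) h k (L := 1)
    (F := fun a => (if y a.1 = false then 1 else 0) * (if y a.2 = true then 1 else 0))
    (fun a => by positivity) (fun a => by split_ifs <;> simp))).1
  have h2 : ∑ p ∈ G.edges ×ˢ (Finset.univ : Finset (Fin M × Fin M)),
      (if y (headCopy p) = false then (1 : ℝ) else 0) * (if y (tailCopy p) = true then 1 else 0) =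
      M ^ 2 * G.cutSize x := by
    rw [cutSize, Finset.mul_sum, Finset.sum_product]
    refine Finset.sum_congr rfl fun e _ => ?_
    refine (Finset.sum_congr rfl (g := fun _ => (if x e.1 = false then (1 : ℝ) else 0) *
      if x e.2 = true then 1 else 0) fun _ _ => rfl).trans ?_
    rw [Finset.sum_const, Finset.card_univ, Fintype.card_prod, Fintype.card_fin, nsmul_eq_mul]
    push_cast
    ring
  have h3 : (G.flippedBlowup M h k).cutSize y = ∑ a ∈ (G.flippedBlowup M h k).edges,
    (if y a.1 = false then (1 : ℝ) else 0) * if y a.2 = true then 1 else 0 := rfl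
  rw [← hx]
  linarith

/-- A small perturbation of the biases hardly changes the guarantee of the rounded cut. -/
theorem sum_edgeWeight_mem_Icc {ℓ : ℕ} {α : ℝ} (hα : 0 ≤ α) {t r : Fin ℓ → ℝ}
    (hr : ∀ i, r i ∈ Set.Icc (0 : ℝ) 1) (hsnap : HasSnapshotRatio α t r) (G : SimpleDigraph V)
    {ε : ℝ} (hε : 0 < ε) {β : V → ℝ} (hβ : ∀ v, β v ∈ Set.Icc (-1 : ℝ) 1)
    (hβε : ∀ v, |β v - G.bias v| ≤ ε) :
    ∑ e ∈ G.edges, edgeWeight t r (β e.1) (β e.2) ∈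
      Set.Icc (α * G.maxDicut - 4 * (1 + α + ℓ ^ 2) * ε * G.numEdges)
        (G.maxDicut + 4 * (1 + α + ℓ ^ 2) * ε * G.numEdges) := by
  -- As there are finitely many vertices and thresholds, some gap `η` separates every `β v` from all
  -- thresholds above it. An overshoot of `2 / M < η` then crosses no threshold.
  obtain ⟨η, hη, hηt⟩ : ∃ η > (0 : ℝ), ∀ v i, β v < t i → β v + η < t i := by
    have : ∀ᶠ η in nhdsWithin (0 : ℝ) (Set.Ioi 0), ∀ v i, β v < t i → β v + η < t i := by
      simp only [Filter.eventually_all]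
      intro v i hvi
      filter_upwards [Ioo_mem_nhdsGT (sub_pos.2 hvi)] with η hη
      linarith [hη.2]
    obtain ⟨η, h1, h2⟩ := (this.and self_mem_nhdsWithin).exists
    exact ⟨η, h2, h1⟩
  obtain ⟨M, hM⟩ := exists_nat_gt (2 / min η ε)
  have hmin : 0 < min η ε := lt_min hη hε
  have hM0 : (0 : ℝ) < M := lt_trans (by positivity) hM
  have hMpos : 0 < M := by exact_mod_cast hM0
  have hMη : 2 / (M : ℝ) < min η ε := by
    rw [div_lt_iff₀ hmin] at hM
    rw [div_lt_iff₀ hM0]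
    linarith
  have hMε : 2 ≤ M * ε := by
    have := hMη.trans_le (min_le_right _ _)
    rw [div_lt_iff₀ hM0] at this
    linarith
  have : Nonempty (Fin M) := ⟨⟨0, hMpos⟩⟩
  choose h hh k hk hlow hup hcost using fun v => exists_flips (G.bias_mem_Icc v) (hβ v) hMpos
  have hbias : ∀ v, 0 < G.degree v → ∀ a : Fin M, ∀ i,
      t i ≤ (G.flippedBlowup M h k).bias (Sum.inl (v, a)) ↔ t i ≤ β v := by
    intro v hv a i
    rw [G.bias_flippedBlowup (hh v) (hk v) a hv.ne']
    refine ⟨fun hi => ?_, fun hi => hi.trans (hlow v)⟩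
    by_contra hlt
    have := hηt v i (not_le.1 hlt)
    have := hup v
    have := hMη.trans_le (min_le_left _ _)
    linarith
  set Bk := G.flippedCount M h k
  -- The flips at `v` cost `M * ε / 2 + 1` per unit of degree, and `2 ≤ M * ε` absorbs the rounding
  -- term. The degrees sum to `2m`.
  have hBk : Bk ≤ M ^ 2 * (2 * ε * G.numEdges) := by
    refine (G.flippedCount_le hh hk).trans ?_
    have : ∑ v, (G.outDegree v * h v + G.inDegree v * k v : ℝ) ≤ ∑ v, M * ε * (G.degree v : ℝ) := by
      refine Finset.sum_le_sum fun v _ => ?_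
      have h1 := G.bias_mul_degree v
      have h2 : (G.degree v : ℝ) = G.outDegree v + G.inDegree v := by
        exact_mod_cast G.degree_eq_add v
      have ho : (G.outDegree v : ℝ) = G.degree v * ((1 + G.bias v) / 2) := by linarith
      have hi : (G.inDegree v : ℝ) = G.degree v * ((1 - G.bias v) / 2) := by linarith
      have h3 : (M : ℝ) * |β v - G.bias v| ≤ M * ε := by gcongr; exact hβε v
      calc _ = G.degree v * ((1 + G.bias v) / 2 * h v + (1 - G.bias v) / 2 * k v) := by
            rw [ho, hi]; ring
        _ ≤ G.degree v * (M * ε) := by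
            refine mul_le_mul_of_nonneg_left ?_ (Nat.cast_nonneg _)
            linarith [hcost v]
        _ = _ := by ring
    calc _ ≤ M * ∑ v, M * ε * (G.degree v : ℝ) := by gcongr
      _ = _ := by rw [← Finset.mul_sum, sum_degree]; ring
  have hval := abs_le.1 (G.abs_sum_flippedBlowup_sub_le h k
    (F := fun a => edgeWeight t r ((G.flippedBlowup M h k).bias a.1)
      ((G.flippedBlowup M h k).bias a.2)) (fun a => edgeWeight_nonneg t hr _ _)
      (fun a => edgeWeight_le t hr _ _))
  have hsum : ∑ p ∈ G.edges ×ˢ (Finset.univ : Finset (Fin M × Fin M)),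
      edgeWeight t r ((G.flippedBlowup M h k).bias (headCopy p))
        ((G.flippedBlowup M h k).bias (tailCopy p)) =
      M ^ 2 * ∑ e ∈ G.edges, edgeWeight t r (β e.1) (β e.2) := by
    rw [Finset.mul_sum, Finset.sum_product]
    refine Finset.sum_congr rfl fun e he => ?_
    rw [Finset.sum_congr rfl (g := fun _ => edgeWeight t r (β e.1) (β e.2))]
    · simp [sq]
    · intro ij _
      unfold edgeWeight
      congr 1
      · exact intervalWeight_congr r (bias_mem_Icc _ _).2 (hβ _).2
          (hbias _ (G.degree_pos_of_mem he (Or.inl rfl)) _)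
      · exact intervalWeight_congr (1 - r) (bias_mem_Icc _ _).2 (hβ _).2
          (hbias _ (G.degree_pos_of_mem he (Or.inr rfl)) _)
  rw [hsum, ← cutValue_snapshot] at hval
  obtain ⟨-, -, hs1, hs2⟩ := hsnap _ (G.flippedBlowup M h k)
  have hu := G.maxDicut_flippedBlowup_le (M := M) h k
  have hl := mul_le_mul_of_nonneg_left (G.le_maxDicut_flippedBlowup (M := M) h k) hα
  -- Per flipped copy, `2 * ℓ ^ 2` is lost in the rounded value and `2`, respectively `2 * α`, in
  -- the maximum cut; there are at most `2 ε m M²` such copies.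
  have hK : (2 + 2 * α + 2 * ℓ ^ 2) * Bk ≤
      (2 + 2 * α + 2 * ℓ ^ 2) * (M ^ 2 * (2 * ε * G.numEdges)) := by gcongr
  have hBk0 : 0 ≤ Bk := Finset.sum_nonneg fun p _ => by split_ifs <;> simp
  have hαB : 0 ≤ α * Bk := by positivity
  have hM2 : (0 : ℝ) < M ^ 2 := by positivity
  constructor
  · refine le_of_mul_le_mul_left ?_ hM2
    nlinarith [hval.2]
  · refine le_of_mul_le_mul_left ?_ hM2
    nlinarith [hval.1]

end SimpleDigraph

/-! ### Degree levels -/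

lemma lt_pow_lastLevel {N : ℕ} (hN : 0 < N) {ε : ℝ} (hε : 0 < ε) :
    (N : ℝ) < (1 + ε ^ 3) ^ (lastLevel N ε + 1) := by
  have h1 : (1 : ℝ) < 1 + ε ^ 3 := by linarith [pow_pos hε 3]
  have hN' : (0 : ℝ) < N := by exact_mod_cast hN
  rw [← Real.rpow_natCast, ← Real.logb_lt_iff_lt_rpow h1 hN']
  push_cast
  exact Nat.lt_floor_add_one _

/-- The degree thresholds form a geometric scale of ratio `1 + O(ε³)`. -/
lemma degThreshold_degLevel {N D : ℕ} {ε : ℝ} (hε : 0 < ε) (hε1 : ε ≤ 1) (hD : 0 < D) (hDN : D ≤ N) :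
    1 ≤ degThreshold N ε (degLevel N ε D) ∧ degThreshold N ε (degLevel N ε D) ≤ D ∧
      (D : ℝ) - degThreshold N ε (degLevel N ε D) ≤
        6 * ε ^ 3 * degThreshold N ε (degLevel N ε D) := by
  have hN : 0 < N := hD.trans_le hDN
  have hε3 : 0 < ε ^ 3 := pow_pos hε 3
  have hε31 : ε ^ 3 ≤ 1 := pow_le_one₀ hε.le hε1
  set K := lastLevel N ε with hK
  -- `Nat.findGreatest` also returns `0` when nothing satisfies the predicate, so index `0` has to
  -- be checked. If it is already the last one, then its threshold is `N`, and `N < 2` forces `D = N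
  -- = 1`.
  have hP0 : degThreshold N ε 0 ≤ D := by
    unfold degThreshold
    split_ifs with h
    · rw [pow_zero, Nat.floor_one]
      exact hD
    · have hK0 : K = 0 := by omega
      have := lt_pow_lastLevel hN hε
      rw [← hK, hK0, zero_add, pow_one] at this
      have : (N : ℝ) < 2 := by linarith
      have : N < 2 := by exact_mod_cast this
      omega
  set i := Nat.findGreatest (fun i => degThreshold N ε i ≤ D) K with hi
  have hlev : ((degLevel N ε D : Fin (lastLevel N ε + 1)) : ℕ) = i := rfl
  rw [hlev]
  have hiD : degThreshold N ε i ≤ D :=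
    Nat.findGreatest_spec (P := fun i => degThreshold N ε i ≤ D) (Nat.zero_le K) hP0
  have hiK : i ≤ K := Nat.findGreatest_le _
  rcases hiK.eq_or_lt with hiK | hiK
  · have hN' : degThreshold N ε i = N := by rw [degThreshold, if_neg]; omega
    rw [hN'] at hiD ⊢
    have : D = N := le_antisymm hDN hiD
    subst this
    refine ⟨hD, le_rfl, ?_⟩
    rw [sub_self]
    positivity
  · have hdi : degThreshold N ε i = ⌊(1 + ε ^ 3) ^ i⌋₊ := if_pos hiK
    have hge : (1 : ℝ) ≤ (1 + ε ^ 3) ^ i := one_le_pow₀ (by linarith)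
    have h1 : 1 ≤ degThreshold N ε i := by
      rw [hdi]
      exact Nat.le_floor (by simpa using hge)
    refine ⟨h1, hiD, ?_⟩
    have hnext : D < degThreshold N ε (i + 1) := by
      by_contra! hcon
      exact absurd (Nat.le_findGreatest (P := fun i => degThreshold N ε i ≤ D) hiK hcon)
        (by rw [← hi]; omega)
    have hfl : (1 + ε ^ 3) ^ i < (degThreshold N ε i : ℝ) + 1 := by
      rw [hdi]
      exact Nat.lt_floor_add_one _
    -- The exponent is `2` because of the last step of the scale, where `N` is only known to be
    -- below the power `K + 1 = i + 2`. The `+ 1` on the left cancels the loss from the floor in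
    -- `hfl`.
    have hD1 : (D : ℝ) + 1 ≤ (1 + ε ^ 3) ^ i * (1 + ε ^ 3) ^ 2 := by
      have hD2 : (D : ℝ) + 1 ≤ degThreshold N ε (i + 1) := by exact_mod_cast hnext
      refine hD2.trans ?_
      unfold degThreshold
      split_ifs with h
      · refine (Nat.floor_le (by positivity)).trans ?_
        rw [← pow_add]
        exact pow_le_pow_right₀ (by linarith) (by omega)
      · have := lt_pow_lastLevel hN hε
        rw [← hK, show K + 1 = i + 2 by omega, pow_add] at this
        exact this.le
    have h1' : (1 : ℝ) ≤ degThreshold N ε i := by exact_mod_cast h1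
    set q := (degThreshold N ε i : ℝ)
    set P := (1 + ε ^ 3) ^ i
    set δ := ε ^ 3
    -- Here `(1 + δ)² - 1 ≤ 3δ` because `δ ≤ 1`, and `P < q + 1 ≤ 2q` turns `3` into `6`.
    have e1 : P * (1 + δ) ^ 2 - P ≤ 3 * δ * P := by nlinarith [mul_pos (by linarith : 0 < P) hε3]
    have e2 : 3 * δ * P ≤ 3 * δ * (2 * q) := by gcongr; linarith
    linarith

/-! ### Sampled counts -/

/-- The count is a sum of independent Bernoulli variables, so the variances add up. -/
lemma integral_sq_sampled_sub {ι : Type*} [Fintype ι] [DecidableEq ι] (p : ι → unitInterval) (S : Finset ι) :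
    ∫ ω, (((S.filter fun x => ω x = true).card : ℝ) - ∑ x ∈ S, (p x : ℝ)) ^ 2
      ∂(Measure.pi fun x => bernoulliMeasure true false (p x)) =
      ∑ x ∈ S, (p x : ℝ) * (1 - p x) := by
  let X : ι → Bool → ℝ := fun x b => if x ∈ S then (if b = true then 1 else 0) else 0
  have hX : ∀ x, MemLp (X x) 2 (bernoulliMeasure true false (p x)) := fun x => MemLp.of_discrete
  have hsum : ∀ ω : ι → Bool, (∑ x, fun ω : ι → Bool => X x (ω x)) ω =
      ((S.filter fun x => ω x = true).card : ℝ) := fun ω => by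
    simp [X, Finset.sum_apply, Finset.sum_boole]
  have hmean : ∫ ω, (∑ x, fun ω : ι → Bool => X x (ω x)) ω
      ∂(Measure.pi fun x => bernoulliMeasure true false (p x)) = ∑ x ∈ S, (p x : ℝ) := by
    simp only [Finset.sum_apply]
    rw [integral_finsetSum _ fun x _ => Integrable.of_finite]
    have : ∀ x, ∫ ω : ι → Bool, X x (ω x) ∂(Measure.pi fun x => bernoulliMeasure true false (p x)) =
        if x ∈ S then (p x : ℝ) else 0 := fun x => by
      have h := integral_comp_eval (μ := fun x => bernoulliMeasure true false (p x)) (i := x)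
        (f := X x) (hX x).aestronglyMeasurable
      rw [h, integral_bernoulliMeasure]
      by_cases hx : x ∈ S <;> simp [X, hx]
    simp [this]
  have hvar := variance_sum_pi hX
  rw [variance_eq_integral (by fun_prop), hmean] at hvar
  simp only [hsum] at hvar
  rw [hvar]
  have : ∀ x, Var[X x; bernoulliMeasure true false (p x)] =
      if x ∈ S then (p x : ℝ) * (1 - p x) else 0 := fun x => by
    rw [variance_eq_sub (hX x), integral_bernoulliMeasure, integral_bernoulliMeasure]
    by_cases hx : x ∈ S
    · simp [X, hx]; ring
    · simp [X, hx]
  simp [this]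

/-! ### Uniform noise -/

lemma cond_Icc_Ico_le {ε : ℝ} (hε : 0 < ε) (a b : ℝ) :
    ProbabilityTheory.cond (volume : Measure ℝ) (Set.Icc (-ε) ε) (Set.Ico a b) ≤
      ENNReal.ofReal ((b - a) / (2 * ε)) := by
  rw [cond_apply measurableSet_Icc, Real.volume_Icc, ENNReal.ofReal_div_of_pos (by positivity),
    ENNReal.div_eq_inv_mul, show ε - -ε = 2 * ε by ring]
  gcongr
  exact (measure_mono Set.inter_subset_right).trans Real.volume_Ico.le

instance isProbabilityMeasure_cond_Icc {ε : ℝ} [Fact (0 < ε)] :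
    IsProbabilityMeasure (ProbabilityTheory.cond (volume : Measure ℝ) (Set.Icc (-ε) ε)) := by
  have : 0 < ε := Fact.out
  refine cond_isProbabilityMeasure_of_finite ?_ ?_
  · simp [Real.volume_Icc]; linarith
  · simp [Real.volume_Icc]

/-! ### The error of the pseudobias before the noise is added -/

/-- The law of the bits `f_i(e)`. -/
abbrev bitLaw (V : Type) [Fintype V] (N : ℕ) (ε κ : ℝ) :
    Measure (Fin (lastLevel N ε + 1) × (V × V) → Bool) :=
  Measure.pi fun x => bernoulliMeasure true false (sampleProb N ε κ (x.1 : ℕ))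

section

variable {V : Type} [DecidableEq V]

/-- The pseudobias without noise and without cut-off. -/
def rawBias (G : SimpleDigraph V) (τ : V × V → ℕ) (N : ℕ) (ε κ : ℝ) (e : V × V) (v : V)
    (f : Fin (lastLevel N ε + 1) × (V × V) → Bool) : ℝ :=
  2 * ((outEstimate G τ N ε κ (f, 0) e v + (outAfter G τ e v : ℝ)) /
    ((degThreshold N ε (levelAt G τ N ε e v : ℕ) : ℝ) + (degAfter G τ e v : ℝ))) - 1

/-- The estimate of the out-degree never looks at the noise, so the zero noise in `rawBias` is a
harmless placeholder. -/
lemma pseudobias_eq (G : SimpleDigraph V) (τ : V × V → ℕ) (N : ℕ) (ε κ : ℝ)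
    (ω : HashOutcome V N ε) (e : V × V) (v : V) :
    pseudobias G τ N ε κ ω e v = max (-1) (min (rawBias G τ N ε κ e v ω.1 + ω.2 v) 1) := rfl

/-- The edges with head `v` among `e` and the edges that arrive before `e`. -/
def outUpTo (G : SimpleDigraph V) (τ : V × V → ℕ) (e : V × V) (v : V) : Finset (V × V) :=
  G.edges.filter fun e' => e'.1 = v ∧ τ e' ≤ τ e

variable (G : SimpleDigraph V) (τ : V × V → ℕ) (e : V × V) (v : V)

lemma card_outUpTo_add_outAfter : (outUpTo G τ e v).card + outAfter G τ e v = G.outDegree v := by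
  have := Finset.card_filter_add_card_filter_not (s := G.edges.filter fun e' => e'.1 = v)
    (fun e' => τ e' ≤ τ e)
  rw [SimpleDigraph.outDegree, ← this]
  simp only [Finset.filter_filter, not_le, outUpTo, outAfter]

lemma degUpTo_add_degAfter : degUpTo G τ e v + degAfter G τ e v = G.degree v := by
  have := Finset.card_filter_add_card_filter_not (s := G.edges.filter fun e' => e'.1 = v ∨ e'.2 = v)
    (fun e' => τ e' ≤ τ e)
  rw [SimpleDigraph.degree, ← this]
  simp only [Finset.filter_filter, not_le, degUpTo, degAfter]

lemma card_outUpTo_le : (outUpTo G τ e v).card ≤ degUpTo G τ e v :=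
  Finset.card_le_card fun _ h => by
    simp only [outUpTo, Finset.mem_filter] at h ⊢
    exact ⟨h.1, Or.inl h.2.1, h.2.2⟩

lemma degUpTo_pos (he : e ∈ G.edges) (hv : e.1 = v ∨ e.2 = v) : 0 < degUpTo G τ e v :=
  Finset.card_pos.2 ⟨e, Finset.mem_filter.2 ⟨he, hv, le_rfl⟩⟩

lemma outEstimate_eq (N : ℕ) (ε κ : ℝ) (ω : HashOutcome V N ε) :
    outEstimate G τ N ε κ ω e v =
      ((((outUpTo G τ e v).map ⟨Prod.mk (levelAt G τ N ε e v), Prod.mk_right_injective _⟩).filter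
        fun x => ω.1 x = true).card : ℝ) / (sampleProb N ε κ (levelAt G τ N ε e v : ℕ) : ℝ) := by
  rw [outEstimate, Finset.filter_map, Finset.card_map, outUpTo, Finset.filter_filter]
  simp only [Function.comp_def, Function.Embedding.coeFn_mk, and_assoc]

lemma sampleProb_pos {N : ℕ} {ε κ : ℝ} (hκ : 0 < κ) {i : ℕ} (hi : 1 ≤ degThreshold N ε i) :
    0 < (sampleProb N ε κ i : ℝ) := by
  have : (0 : ℝ) < degThreshold N ε i := by exact_mod_cast hi
  rw [sampleProb, Set.coe_projIcc]
  have : 0 < κ / (2 * (degThreshold N ε i : ℝ)) := by positivity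
  simp [this]

/-- This is the variance per edge after division by the squared probability. It vanishes when the
probability is cut off at `1`. -/
lemma one_sub_sampleProb_div_le {N : ℕ} {ε κ : ℝ} (hκ : 0 < κ) {i : ℕ}
    (hi : 1 ≤ degThreshold N ε i) :
    (1 - (sampleProb N ε κ i : ℝ)) / sampleProb N ε κ i ≤ 2 * degThreshold N ε i / κ := by
  have hq : (0 : ℝ) < degThreshold N ε i := by exact_mod_cast hi
  have hpos := sampleProb_pos (N := N) (ε := ε) hκ hi
  have hp : (sampleProb N ε κ i : ℝ) = max 0 (min 1 (κ / (2 * (degThreshold N ε i : ℝ)))) := by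
    rw [sampleProb, Set.coe_projIcc]
  have h0 : 0 < κ / (2 * (degThreshold N ε i : ℝ)) := by positivity
  rcases le_total 1 (κ / (2 * (degThreshold N ε i : ℝ))) with h | h
  · rw [hp, min_eq_left h]
    simp
    positivity
  · rw [min_eq_right h, max_eq_right h0.le] at hp
    rw [div_le_iff₀ hpos, hp]
    field_simp
    linarith

/-- The error splits into the sampling error, over a denominator of at least `q`, and the rounding
error of the degree, which is at most `2 * (6 * ε ^ 3)`. The sampling error enters squared so that
its variance can be used. -/
lemma abs_rawBias_sub_bias_le {N : ℕ} {ε κ : ℝ} (hε : 0 < ε) (hε1 : ε ≤ 1)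
    (hN : G.degree v ≤ N) (he : e ∈ G.edges) (hv : e.1 = v ∨ e.2 = v)
    (f : Fin (lastLevel N ε + 1) × (V × V) → Bool) :
    |rawBias G τ N ε κ e v f - G.bias v| ≤
      (outEstimate G τ N ε κ (f, 0) e v - (outUpTo G τ e v).card) ^ 2 /
        (degThreshold N ε (levelAt G τ N ε e v) ^ 2 * ε ^ 3) + 13 * ε ^ 3 := by
  have hD := degUpTo_pos G τ e v he hv
  have hsum := degUpTo_add_degAfter G τ e v
  obtain ⟨hq1, hqD, hDq⟩ := degThreshold_degLevel hε hε1 hD (N := N) (by omega)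
  change 1 ≤ degThreshold N ε (levelAt G τ N ε e v) at hq1
  change degThreshold N ε (levelAt G τ N ε e v) ≤ _ at hqD
  change _ - (degThreshold N ε (levelAt G τ N ε e v) : ℝ) ≤
    6 * ε ^ 3 * (degThreshold N ε (levelAt G τ N ε e v) : ℝ) at hDq
  have hb := G.bias_mul_degree v
  have hdeg : (G.degree v : ℝ) = G.outDegree v + G.inDegree v := by
    exact_mod_cast G.degree_eq_add v
  have hout : ((outUpTo G τ e v).card : ℝ) + outAfter G τ e v = G.outDegree v := by
    exact_mod_cast card_outUpTo_add_outAfter G τ e v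
  have hsum' : (degUpTo G τ e v : ℝ) + degAfter G τ e v = G.degree v := by exact_mod_cast hsum
  have hq1' : (1 : ℝ) ≤ degThreshold N ε (levelAt G τ N ε e v) := by exact_mod_cast hq1
  have hqD' : (degThreshold N ε (levelAt G τ N ε e v) : ℝ) ≤ degUpTo G τ e v := by
    exact_mod_cast hqD
  have hda : (0 : ℝ) ≤ degAfter G τ e v := Nat.cast_nonneg _
  have hin : (0 : ℝ) ≤ G.inDegree v := Nat.cast_nonneg _
  have hod : (0 : ℝ) ≤ G.outDegree v := Nat.cast_nonneg _
  unfold rawBias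
  set q := (degThreshold N ε (levelAt G τ N ε e v) : ℝ)
  set O := ((outUpTo G τ e v).card : ℝ)
  set X := outEstimate G τ N ε κ (f, 0) e v
  set d := (G.degree v : ℝ)
  set o := (G.outDegree v : ℝ)
  set da := (degAfter G τ e v : ℝ)
  have hε3 : 0 < ε ^ 3 := pow_pos hε 3
  have hd0 : 0 < d := by linarith
  have hq0 : 0 < q := by linarith
  have hq' : 0 < q + da := by linarith
  have hbias : G.bias v = 2 * (o / d) - 1 := by
    field_simp
    linarith
  have hsplit : 2 * ((X + outAfter G τ e v) / (q + da)) - 1 - G.bias v =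
      2 * ((X - O) / (q + da)) + 2 * (o / d * ((d - (q + da)) / (q + da))) := by
    rw [hbias, ← hout]
    field_simp
    ring
  have hfst : |2 * ((X - O) / (q + da))| ≤ 2 * (|X - O| / q) := by
    rw [abs_mul, abs_div, abs_two, abs_of_pos hq']
    gcongr
    linarith
  have hsnd : |2 * (o / d * ((d - (q + da)) / (q + da)))| ≤ 12 * ε ^ 3 := by
    have h1 : 0 ≤ (d - (q + da)) / (q + da) := div_nonneg (by linarith) hq'.le
    have h2 : (d - (q + da)) / (q + da) ≤ 6 * ε ^ 3 := by
      rw [div_le_iff₀ hq']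
      have : 0 ≤ 6 * ε ^ 3 * da := by positivity
      linarith
    have h3 : o / d ≤ 1 := by rw [div_le_one hd0]; linarith
    have h4 : 0 ≤ o / d := by positivity
    rw [abs_of_nonneg (by positivity)]
    calc _ ≤ 2 * (1 * (6 * ε ^ 3)) := by gcongr
      _ = _ := by ring
  -- The inequality `2z ≤ z² / ε³ + ε³`; its last term makes `12` into `13`.
  have ham : 2 * (|X - O| / q) ≤ (X - O) ^ 2 / (q ^ 2 * ε ^ 3) + ε ^ 3 := by
    have h1 : (X - O) ^ 2 / (q ^ 2 * ε ^ 3) = (|X - O| / q) ^ 2 / ε ^ 3 := by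
      rw [div_pow, sq_abs, div_div]
    rw [h1]
    set z := |X - O| / q
    have : z ^ 2 / ε ^ 3 + ε ^ 3 - 2 * z = (z - ε ^ 3) ^ 2 / ε ^ 3 := by
      field_simp
      ring
    have : 0 ≤ (z - ε ^ 3) ^ 2 / ε ^ 3 := by positivity
    linarith
  rw [hsplit]
  refine (abs_add_le _ _).trans ?_
  linarith

variable [Fintype V]

lemma integral_sq_outEstimate_sub {N : ℕ} {ε κ : ℝ} (hκ : 0 < κ)
    (hq : 1 ≤ degThreshold N ε (levelAt G τ N ε e v)) :
    ∫ f, (outEstimate G τ N ε κ (f, 0) e v - (outUpTo G τ e v).card) ^ 2 ∂(bitLaw V N ε κ) ≤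
      (outUpTo G τ e v).card * (2 * degThreshold N ε (levelAt G τ N ε e v) / κ) := by
  set i := levelAt G τ N ε e v with hi
  set p := (sampleProb N ε κ (i : ℕ) : ℝ) with hp
  have hp0 : 0 < p := sampleProb_pos hκ hq
  set S := (outUpTo G τ e v).map ⟨Prod.mk i, Prod.mk_right_injective _⟩ with hS
  have h := integral_sq_sampled_sub
    (fun x : Fin (lastLevel N ε + 1) × (V × V) => sampleProb N ε κ (x.1 : ℕ)) S
  simp only [hS, Finset.sum_map, Function.Embedding.coeFn_mk, Finset.sum_const, nsmul_eq_mul] at h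
  have h1 : ∀ f : Fin (lastLevel N ε + 1) × (V × V) → Bool,
      (outEstimate G τ N ε κ (f, 0) e v - (outUpTo G τ e v).card) ^ 2 =
      (p ^ 2)⁻¹ * (((S.filter fun x => f x = true).card : ℝ) - (outUpTo G τ e v).card * p) ^ 2 := by
    intro f
    rw [outEstimate_eq, ← hi, ← hp, ← hS]
    field_simp
  simp only [h1]
  rw [integral_const_mul, h]
  calc _ = (outUpTo G τ e v).card * ((1 - p) / p) := by rw [← hp]; field_simp
    _ ≤ _ := by
      exact mul_le_mul_of_nonneg_left (one_sub_sampleProb_div_le hκ hq) (Nat.cast_nonneg _)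

lemma integral_abs_rawBias_sub_bias_le {N : ℕ} {ε κ : ℝ} (hε : 0 < ε) (hε1 : ε ≤ 1) (hκ : 0 < κ)
    (hN : G.degree v ≤ N) (he : e ∈ G.edges) (hv : e.1 = v ∨ e.2 = v) :
    ∫ f, |rawBias G τ N ε κ e v f - G.bias v| ∂(bitLaw V N ε κ) ≤
      14 / (κ * ε ^ 3) + 13 * ε ^ 3 := by
  have hD := degUpTo_pos G τ e v he hv
  have hsum := degUpTo_add_degAfter G τ e v
  obtain ⟨hq1, hqD, hDq⟩ := degThreshold_degLevel hε hε1 hD (N := N) (by omega)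
  change 1 ≤ degThreshold N ε (levelAt G τ N ε e v) at hq1
  change _ - (degThreshold N ε (levelAt G τ N ε e v) : ℝ) ≤
    6 * ε ^ 3 * (degThreshold N ε (levelAt G τ N ε e v) : ℝ) at hDq
  have hint := integral_sq_outEstimate_sub G τ e v hκ hq1
  have hO : ((outUpTo G τ e v).card : ℝ) ≤ degUpTo G τ e v := by
    exact_mod_cast card_outUpTo_le G τ e v
  refine (integral_mono .of_finite .of_finite fun f =>
    abs_rawBias_sub_bias_le (κ := κ) G τ e v hε hε1 hN he hv f).trans ?_
  rw [integral_add .of_finite .of_finite, integral_div, integral_const]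
  simp only [probReal_univ, one_smul]
  refine add_le_add_left ?_ _
  have hq1' : (1 : ℝ) ≤ degThreshold N ε (levelAt G τ N ε e v) := by exact_mod_cast hq1
  set q := (degThreshold N ε (levelAt G τ N ε e v) : ℝ)
  have hq0 : 0 < q := by linarith
  have hε3 : 0 < ε ^ 3 := pow_pos hε 3
  have hε31 : ε ^ 3 ≤ 1 := pow_le_one₀ hε.le hε1
  -- The degree so far is at most `(1 + 6 * ε ^ 3) * q`, and `ε ≤ 1`.
  have hO7 : ((outUpTo G τ e v).card : ℝ) ≤ 7 * q := by nlinarith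
  calc _ ≤ ((outUpTo G τ e v).card * (2 * q / κ)) / (q ^ 2 * ε ^ 3) := by gcongr
    _ ≤ (7 * q * (2 * q / κ)) / (q ^ 2 * ε ^ 3) := by gcongr
    _ = _ := by field_simp; norm_num

end

/-! ### Misclassified edges -/

section

/-- The law of the noise `g`. -/
abbrev noiseLaw (V : Type) [Fintype V] (ε : ℝ) : Measure (V → ℝ) :=
  Measure.pi fun _ : V => ProbabilityTheory.cond (volume : Measure ℝ) (Set.Icc (-ε) ε)

variable {V : Type} [DecidableEq V]

/-- The outcomes for which some threshold separates the noisy bias of `v` from its noisy estimate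
when `e` arrives. -/
def misclassified {ℓ : ℕ} (t : Fin ℓ → ℝ) (G : SimpleDigraph V) (τ : V × V → ℕ) (N : ℕ) (ε κ : ℝ)
    (e : V × V) (v : V) : Set (HashOutcome V N ε) :=
  ⋃ i, {ω | ω.2 v ∈ Set.Ico (min (t i - rawBias G τ N ε κ e v ω.1) (t i - G.bias v))
    (max (t i - rawBias G τ N ε κ e v ω.1) (t i - G.bias v))}

variable {ℓ : ℕ} {t : Fin ℓ → ℝ} {G : SimpleDigraph V} {τ : V × V → ℕ} {N : ℕ} {ε κ : ℝ}
  {e : V × V} {v : V}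

/-- The inequality `t i ≤ x + g` means `t i - x ≤ g`; two values of `x` disagree on it exactly when
`g` lies in the half-open interval between the two differences. -/
lemma le_iff_le_of_notMem_misclassified {ω : HashOutcome V N ε}
    (hω : ω ∉ misclassified t G τ N ε κ e v) (i : Fin ℓ) :
    t i ≤ rawBias G τ N ε κ e v ω.1 + ω.2 v ↔ t i ≤ G.bias v + ω.2 v := by
  simp only [misclassified, Set.mem_iUnion, Set.mem_ofPred_eq, Set.mem_Ico, not_exists, not_and,
    min_le_iff, lt_max_iff, not_or, not_lt] at hω
  have := hω i
  constructor <;> intro h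
  · linarith [(this (Or.inl (by linarith))).2]
  · linarith [(this (Or.inr (by linarith))).1]

variable [Fintype V]

lemma measurableSet_misclassified : MeasurableSet (misclassified t G τ N ε κ e v) := by
  have h : Measurable fun ω : HashOutcome V N ε => rawBias G τ N ε κ e v ω.1 :=
    (Measurable.of_discrete (f := rawBias G τ N ε κ e v)).comp measurable_fst
  refine MeasurableSet.iUnion fun i => ?_
  have h1 : Measurable fun ω : HashOutcome V N ε =>
    min (t i - rawBias G τ N ε κ e v ω.1) (t i - G.bias v) := by fun_prop
  have h2 : Measurable fun ω : HashOutcome V N ε =>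
    max (t i - rawBias G τ N ε κ e v ω.1) (t i - G.bias v) := by fun_prop
  have h3 : Measurable fun ω : HashOutcome V N ε => ω.2 v := by fun_prop
  exact (measurableSet_le h1 h3).inter (measurableSet_lt h3 h2)

lemma isProbabilityMeasure_hashLaw (hε : 0 < ε) : IsProbabilityMeasure (hashLaw V N ε κ) := by
  have : Fact (0 < ε) := ⟨hε⟩
  unfold hashLaw
  infer_instance

/-- For fixed bits, each threshold asks the noise to hit an interval of length `|rawBias - bias|`,
which has probability at most that length over `2 * ε`. Integrating over the independent bits leaves
the mean error. -/
lemma hashLaw_misclassified_le (hε : 0 < ε) (hε1 : ε ≤ 1) (hκ : 0 < κ)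
    (hN : G.degree v ≤ N) (he : e ∈ G.edges) (hv : e.1 = v ∨ e.2 = v) :
    (hashLaw V N ε κ).real (misclassified t G τ N ε κ e v) ≤
      ℓ / (2 * ε) * (14 / (κ * ε ^ 3) + 13 * ε ^ 3) := by
  have : Fact (0 < ε) := ⟨hε⟩
  have hslice : ∀ f, noiseLaw V ε (Prod.mk f ⁻¹' misclassified t G τ N ε κ e v) ≤
      ENNReal.ofReal (ℓ / (2 * ε) * |rawBias G τ N ε κ e v f - G.bias v|) := by
    intro f
    simp only [misclassified, Set.preimage_iUnion]
    calc _ ≤ ∑ i : Fin ℓ, noiseLaw V ε (Prod.mk f ⁻¹' {ω : HashOutcome V N ε | ω.2 v ∈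
            Set.Ico (min (t i - rawBias G τ N ε κ e v ω.1) (t i - G.bias v))
              (max (t i - rawBias G τ N ε κ e v ω.1) (t i - G.bias v))}) :=
          measure_iUnion_fintype_le _ _
      _ ≤ ∑ i : Fin ℓ, ENNReal.ofReal (|rawBias G τ N ε κ e v f - G.bias v| / (2 * ε)) := by
          refine Finset.sum_le_sum fun i _ => ?_
          refine ((measurePreserving_eval (fun _ : V => ProbabilityTheory.cond (volume : Measure ℝ)
            (Set.Icc (-ε) ε)) v).measure_preimage (s := Set.Ico
              (min (t i - rawBias G τ N ε κ e v f) (t i - G.bias v))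
              (max (t i - rawBias G τ N ε κ e v f) (t i - G.bias v)))
              (measurableSet_Ico.nullMeasurableSet)).trans_le ?_
          refine (cond_Icc_Ico_le hε _ _).trans_eq ?_
          rw [max_sub_min_eq_abs, sub_sub_sub_cancel_left]
      _ = _ := by
          rw [Finset.sum_const, Finset.card_univ, Fintype.card_fin, nsmul_eq_mul,
            ← ENNReal.ofReal_natCast, ← ENNReal.ofReal_mul (Nat.cast_nonneg _)]
          congr 1
          ring
  have hint := integral_abs_rawBias_sub_bias_le G τ e v hε hε1 hκ hN he hv
  refine ENNReal.toReal_le_of_le_ofReal (by positivity) ?_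
  rw [hashLaw, Measure.prod_apply measurableSet_misclassified]
  refine (lintegral_mono hslice).trans ?_
  rw [← ofReal_integral_eq_lintegral_ofReal .of_finite
    (Filter.Eventually.of_forall fun f => by positivity), integral_const_mul]
  gcongr

lemma hashLaw_noise_notMem (hε : 0 < ε) (v : V) :
    hashLaw V N ε κ {ω | ω.2 v ∉ Set.Icc (-ε) ε} = 0 := by
  have : Fact (0 < ε) := ⟨hε⟩
  have h : MeasurePreserving (fun ω : HashOutcome V N ε => ω.2 v) (hashLaw V N ε κ)
      (ProbabilityTheory.cond (volume : Measure ℝ) (Set.Icc (-ε) ε)) :=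
    (measurePreserving_eval (fun _ : V => ProbabilityTheory.cond (volume : Measure ℝ)
      (Set.Icc (-ε) ε)) v).comp measurePreserving_snd
  refine (h.measure_preimage (s := (Set.Icc (-ε) ε)ᶜ)
    (measurableSet_Icc.compl.nullMeasurableSet)).trans ?_
  rw [cond_apply measurableSet_Icc, Set.inter_compl_self]
  simp

/-- The number of misclassified end points of edges. -/
def misclassifiedCount (t : Fin ℓ → ℝ) (G : SimpleDigraph V) (τ : V × V → ℕ) (N : ℕ) (ε κ : ℝ)
    (ω : HashOutcome V N ε) : ℝ :=
  ∑ e ∈ G.edges, ((misclassified t G τ N ε κ e e.1).indicator 1 ω +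
    (misclassified t G τ N ε κ e e.2).indicator 1 ω)

/-- Markov's inequality for the expected count, by linearity over the `2m` end points; no
independence between edges is needed. -/
lemma hashLaw_misclassifiedCount_le (hε : 0 < ε) (hε1 : ε ≤ 1) (hκ : 0 < κ)
    (hN : ∀ v, G.degree v ≤ N) (hm : 0 < G.numEdges) :
    (hashLaw V N ε κ).real {ω | ε * G.numEdges ≤ misclassifiedCount t G τ N ε κ ω} ≤
      14 * ℓ * ε * (1 + 1 / (ε ^ 6 * κ)) := by
  have := isProbabilityMeasure_hashLaw (V := V) (N := N) (κ := κ) hε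
  have hint : ∀ e v, Integrable ((misclassified t G τ N ε κ e v).indicator (1 : HashOutcome V N ε → ℝ))
      (hashLaw V N ε κ) := fun e v =>
    (integrable_const (1 : ℝ)).indicator measurableSet_misclassified
  have hle : ∫ ω, misclassifiedCount t G τ N ε κ ω ∂(hashLaw V N ε κ) ≤
      G.numEdges * (2 * (ℓ / (2 * ε) * (14 / (κ * ε ^ 3) + 13 * ε ^ 3))) := by
    unfold misclassifiedCount
    rw [integral_finsetSum G.edges (f := fun e ω => (misclassified t G τ N ε κ e e.1).indicator 1 ω +
      (misclassified t G τ N ε κ e e.2).indicator 1 ω) fun e _ => (hint e e.1).add (hint e e.2)]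
    rw [SimpleDigraph.numEdges, ← nsmul_eq_mul, ← Finset.sum_const]
    refine Finset.sum_le_sum fun e he => ?_
    rw [integral_add (hint e e.1) (hint e e.2), integral_indicator_one measurableSet_misclassified,
      integral_indicator_one measurableSet_misclassified]
    have h1 := hashLaw_misclassified_le (t := t) (τ := τ) hε hε1 hκ (hN e.1) he (Or.inl rfl)
    have h2 := hashLaw_misclassified_le (t := t) (τ := τ) hε hε1 hκ (hN e.2) he (Or.inr rfl)
    linarith
  have hmarkov := mul_meas_ge_le_integral_of_nonneg (μ := hashLaw V N ε κ)
    (f := misclassifiedCount t G τ N ε κ)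
    (Filter.Eventually.of_forall fun ω => Finset.sum_nonneg fun e _ =>
      add_nonneg (Set.indicator_nonneg (fun _ _ => zero_le_one) _)
        (Set.indicator_nonneg (fun _ _ => zero_le_one) _))
    (integrable_finsetSum _ fun e _ => (hint e e.1).add (hint e e.2)) (ε * G.numEdges)
  have hm' : (0 : ℝ) < G.numEdges := by exact_mod_cast hm
  refine le_of_mul_le_mul_left ((hmarkov.trans hle).trans ?_) (mul_pos hε hm')
  have : (0 : ℝ) ≤ ℓ * ε ^ 2 * G.numEdges := by positivity
  calc _ = (G.numEdges : ℝ) * ℓ * (14 / (κ * ε ^ 4) + 13 * ε ^ 2) := by field_simp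
    _ ≤ (G.numEdges : ℝ) * ℓ * (14 / (κ * ε ^ 4) + 14 * ε ^ 2) := by gcongr; norm_num
    _ = _ := by field_simp; ring

lemma abs_cutValue_pseudosnapshot_sub_le {r : Fin ℓ → ℝ} (hr : ∀ i, r i ∈ Set.Icc (0 : ℝ) 1) (ω : HashOutcome V N ε) :
    |cutValue r (pseudosnapshot t G τ N ε κ ω) - ∑ e ∈ G.edges,
      edgeWeight t r (max (-1) (min (G.bias e.1 + ω.2 e.1) 1))
        (max (-1) (min (G.bias e.2 + ω.2 e.2) 1))| ≤
      ℓ ^ 2 * misclassifiedCount t G τ N ε κ ω := by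
  have hclass : ∀ (e : V × V) (v : V), ω ∉ misclassified t G τ N ε κ e v → ∀ w,
      intervalWeight t w (pseudobias G τ N ε κ ω e v) =
        intervalWeight t w (max (-1) (min (G.bias v + ω.2 v) 1)) := by
    intro e v h w
    rw [pseudobias_eq]
    refine intervalWeight_congr w (by simp) (by simp) fun i => ?_
    have hi := le_iff_le_of_notMem_misclassified h i
    -- After the cut-off, comparison with `t i` still depends only on the comparison before it.
    simp only [le_max_iff, le_min_iff, hi]
  rw [cutValue_pseudosnapshot, ← Finset.sum_sub_distrib, misclassifiedCount, Finset.mul_sum]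
  refine (Finset.abs_sum_le_sum_abs _ _).trans (Finset.sum_le_sum fun e _ => ?_)
  set a := edgeWeight t r (pseudobias G τ N ε κ ω e e.1) (pseudobias G τ N ε κ ω e e.2) with ha
  set b := edgeWeight t r (max (-1) (min (G.bias e.1 + ω.2 e.1) 1))
    (max (-1) (min (G.bias e.2 + ω.2 e.2) 1)) with hb
  have hab : |a - b| ≤ (ℓ : ℝ) ^ 2 := by
    have := edgeWeight_nonneg t hr (pseudobias G τ N ε κ ω e e.1) (pseudobias G τ N ε κ ω e e.2)
    have := edgeWeight_le t hr (pseudobias G τ N ε κ ω e e.1) (pseudobias G τ N ε κ ω e e.2)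
    have := edgeWeight_nonneg t hr (max (-1) (min (G.bias e.1 + ω.2 e.1) 1))
      (max (-1) (min (G.bias e.2 + ω.2 e.2) 1))
    have := edgeWeight_le t hr (max (-1) (min (G.bias e.1 + ω.2 e.1) 1))
      (max (-1) (min (G.bias e.2 + ω.2 e.2) 1))
    rw [abs_le]
    constructor <;> linarith
  have hsq : (0 : ℝ) ≤ (ℓ : ℝ) ^ 2 := by positivity
  by_cases h1 : ω ∈ misclassified t G τ N ε κ e e.1 <;>
    by_cases h2 : ω ∈ misclassified t G τ N ε κ e e.2
  · simp only [Set.indicator_of_mem, h1, h2, Pi.one_apply]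
    linarith
  · simpa [h1, h2] using hab
  · simpa [h1, h2] using hab
  · have : a = b := by rw [ha, hb, edgeWeight, edgeWeight, hclass e e.1 h1, hclass e e.2 h2]
    simp [this, h1, h2]

end

/-- Markov's inequality beats an exponential tail bound up to a constant multiple of `ε`. -/
lemma tail_bound_le {B b ε x : ℝ} (hb : 0 ≤ b) (hbB : 8 * b ≤ B) (hε : 0 < ε) (hx : 0 < x) :
    1 - B * ε - Real.exp (-x) ≤ max 0 (1 - b * ε * (1 + 1 / x)) := by
  have hexp := Real.exp_pos (-x)
  have hbε : 8 * b * ε ≤ B * ε := by gcongr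
  have hbε0 : 0 ≤ b * ε := by positivity
  rcases le_total 1 x with h1 | h1
  · refine le_max_of_le_right ?_
    have : b * ε * (1 + 1 / x) ≤ b * ε * 2 := by
      gcongr
      rw [one_div]
      linarith [inv_le_one_of_one_le₀ h1]
    linarith
  · rcases le_total (8 * b * ε) x with h2 | h2
    · refine le_max_of_le_right ?_
      have h3 : b * ε * (1 / x) ≤ 1 / 8 := by
        rw [mul_one_div, div_le_iff₀ hx]
        linarith
      have h4 : Real.exp (-1) ≤ Real.exp (-x) := Real.exp_le_exp.2 (by linarith)
      have h5 : (1 / 8 : ℝ) ≤ Real.exp (-1) := by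
        rw [Real.exp_neg, ← one_div]
        exact one_div_le_one_div_of_le (Real.exp_pos 1) (by linarith [Real.exp_one_lt_d9])
      linarith [mul_add (b * ε) 1 (1 / x)]
    · refine le_max_of_le_left ?_
      linarith [Real.add_one_le_exp (-x)]

lemma SimpleDigraph.approximates_of_numEdges_eq_zero {V : Type} [DecidableEq V] [Fintype V]
    (G : SimpleDigraph V) (hm : G.numEdges = 0) {ℓ : ℕ} (t r : Fin ℓ → ℝ) (τ : V × V → ℕ) (N : ℕ)
    (ε κ a C : ℝ) (ω : HashOutcome V N ε) :
    Approximates a (cutValue r (pseudosnapshot t G τ N ε κ ω) - C * ε * (G.numEdges : ℝ))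
      (G.maxDicut : ℝ) := by
  have hE : G.edges = ∅ := Finset.card_eq_zero.1 hm
  have hX : cutValue r (pseudosnapshot t G τ N ε κ ω) = 0 := by
    rw [cutValue_pseudosnapshot, hE, Finset.sum_empty]
  obtain ⟨x, hx⟩ := G.exists_cutSize_eq_maxDicut
  have hM : (G.maxDicut : ℝ) = 0 := by rw [← hx, cutSize, hE, Finset.sum_empty]
  rw [hX, hM, hm]
  simp [Approximates]

end

/-! ### The approximation guarantee. -/

theorem mainTheorem3 (α : ℝ) (hα : 0.4844 < α) (ℓ : ℕ) (t r : Fin ℓ → ℝ)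
    (ht : ∀ i, t i ∈ Set.Icc (-1 : ℝ) 1) (hr : ∀ i, r i ∈ Set.Icc (0 : ℝ) 1)
    (hsnap : HasSnapshotRatio α t r) :
    ∃ C > (0 : ℝ), ∃ A > (0 : ℝ), ∃ B > (0 : ℝ), ∃ c > (0 : ℝ),
      ∀ (V : Type) [Fintype V] [DecidableEq V] (G : SimpleDigraph V)
        (τ : V × V → ℕ), Set.InjOn τ (G.edges : Set (V × V)) →
      ∀ N : ℕ, (∀ v, G.degree v ≤ N) →
      ∀ ε κ : ℝ, 0 < ε → ε ≤ 1 → 0 < κ →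
        1 - B * ε - Real.exp (-(c * (ε ^ 6 * κ))) ≤
          (hashLaw V N ε κ).real
            {ω | Approximates (α - A * ε)
              (cutValue r (pseudosnapshot t G τ N ε κ ω) - C * ε * (G.numEdges : ℝ))
              (G.maxDicut : ℝ)} := by
  have hα0 : 0 < α := by norm_num at hα; linarith
  -- The first summand pays for the noise, the second for `ε m` misclassified end points.
  set C : ℝ := 4 * (1 + α + ℓ ^ 2) + ℓ ^ 2 with hC
  have hC0 : 0 < C := by positivity
  -- The value falls short of `α * G.maxDicut` by at most `2Cεm`, hence by `8Cε` times the maximum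
  -- cut. In `B`, the first summand comes from `tail_bound_le`; the second makes the claim trivial
  -- when `α < 8Cε`, where nonnegativity of the estimate could fail.
  refine ⟨C, hC0, 8 * C, by positivity, 8 * (14 * ℓ) + 8 * C / α, by positivity, 1, one_pos, ?_⟩
  intro V _ _ G τ _ N hN ε κ hε hε1 hκ
  have := isProbabilityMeasure_hashLaw (V := V) (N := N) (κ := κ) hε
  rcases Nat.eq_zero_or_pos G.numEdges with hm | hm
  · have huniv : {ω : HashOutcome V N ε | Approximates (α - 8 * C * ε)
        (cutValue r (pseudosnapshot t G τ N ε κ ω) - C * ε * (G.numEdges : ℝ))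
        (G.maxDicut : ℝ)} = Set.univ :=
      Set.eq_univ_of_forall (G.approximates_of_numEdges_eq_zero hm t r τ N ε κ _ C)
    rw [huniv, probReal_univ]
    have := Real.exp_pos (-(1 * (ε ^ 6 * κ)))
    have : 0 ≤ (8 * (14 * ℓ) + 8 * C / α) * ε := by positivity
    linarith
  rcases lt_or_ge α (8 * C * ε) with hlarge | hsmall
  · refine le_trans ?_ measureReal_nonneg
    have h1 : 1 ≤ 8 * C / α * ε := by
      rw [div_mul_eq_mul_div, one_le_div hα0]
      exact hlarge.le
    have := Real.exp_pos (-(1 * (ε ^ 6 * κ)))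
    have : 0 ≤ 8 * (14 * (ℓ : ℝ)) * ε := by positivity
    linarith [add_mul (8 * (14 * (ℓ : ℝ))) (8 * C / α) ε]
  rw [one_mul]
  refine (tail_bound_le (b := 14 * ℓ) (by positivity) (by simp; positivity) hε
    (by positivity)).trans (max_le measureReal_nonneg ?_)
  set S := {ω : HashOutcome V N ε | Approximates (α - 8 * C * ε)
    (cutValue r (pseudosnapshot t G τ N ε κ ω) - C * ε * (G.numEdges : ℝ)) (G.maxDicut : ℝ)}
  set Bad := {ω : HashOutcome V N ε | ε * G.numEdges ≤ misclassifiedCount t G τ N ε κ ω}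
  set Out := ⋃ v : V, {ω : HashOutcome V N ε | ω.2 v ∉ Set.Icc (-ε) ε}
  have hOut : (hashLaw V N ε κ).real Out = 0 := by
    rw [measureReal_def, measure_iUnion_null fun v => hashLaw_noise_notMem hε v, ENNReal.toReal_zero]
  -- Subadditivity over a cover of the whole space bounds the measure of `S` from below without
  -- measurability of `S`.
  have hcover : Set.univ ⊆ S ∪ (Bad ∪ Out) := by
    intro ω _
    by_contra hω
    simp only [Set.mem_union, not_or] at hω
    obtain ⟨hS, hBad, hOut⟩ := hω
    have hg : ∀ v, ω.2 v ∈ Set.Icc (-ε) ε := by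
      simpa [Out] using hOut
    have hcount : misclassifiedCount t G τ N ε κ ω ≤ ε * G.numEdges := (not_le.1 hBad).le
    refine hS ?_
    have h1 := G.sum_edgeWeight_mem_Icc hα0.le hr hsnap hε
      (β := fun v => max (-1) (min (G.bias v + ω.2 v) 1)) (fun v => by simp) (fun v => by
        obtain ⟨hb1, hb2⟩ := G.bias_mem_Icc v
        obtain ⟨hg1, hg2⟩ := hg v
        rw [abs_le]
        constructor
        · rw [neg_le_sub_iff_le_add, ← sub_le_iff_le_add]
          exact le_max_of_le_right (le_min (by linarith) (by linarith))
        · rw [sub_le_iff_le_add]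
          exact max_le (by linarith) ((min_le_left _ _).trans (by linarith)))
    have h2 := (abs_cutValue_pseudosnapshot_sub_le (t := t) (G := G) (τ := τ) (κ := κ) hr ω).trans
      (mul_le_mul_of_nonneg_left hcount (sq_nonneg (ℓ : ℝ)))
    rw [abs_le] at h2
    have hlow : α * G.maxDicut - 2 * (C * ε * G.numEdges) ≤
        cutValue r (pseudosnapshot t G τ N ε κ ω) - C * ε * G.numEdges := by
      rw [hC]
      linarith [h1.1, h2.1]
    have hup : cutValue r (pseudosnapshot t G τ N ε κ ω) - C * ε * G.numEdges ≤ G.maxDicut := by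
      rw [hC]
      linarith [h1.2, h2.2]
    have hmd : C * ε * G.numEdges ≤ C * ε * (4 * G.maxDicut) := by
      gcongr
      exact G.numEdges_le
    have hX0 : 0 ≤ (α - 8 * C * ε) * G.maxDicut :=
      mul_nonneg (by linarith) (Nat.cast_nonneg _)
    have hlow' : (α - 8 * C * ε) * G.maxDicut ≤
        cutValue r (pseudosnapshot t G τ N ε κ ω) - C * ε * G.numEdges := by linarith
    exact ⟨Nat.cast_nonneg _, hX0.trans hlow', hlow', hup⟩
  have hle := (measureReal_mono (μ := hashLaw V N ε κ) hcover).trans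
    ((measureReal_union_le _ _).trans (add_le_add_right (measureReal_union_le _ _) _))
  have hBad := hashLaw_misclassifiedCount_le (t := t) (τ := τ) hε hε1 hκ hN hm
  rw [probReal_univ, hOut] at hle
  linarith
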